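/- Let $d\ge 2$, let $x\cdot y=x^0y^0-x^1y^1-\dots-x^dy^d$ on $\mathbb R^{d+1}$, and let $C^+=\{\xi:\xi\cdot\xi=0,\ \xi^0>0\}$ be the future light cone, with the $(d-1)$-form $$\alpha(\xi)=(\xi^0)^{-1}\sum_{j=1}^d(-1)^{j+1}\xi^j\,d\xi^1\wedge\dots\wedge\widehat{d\xi^j}\wedge\dots\wedge d\xi^d .$$ Let $\gamma_0$ be the unit sphere $C^+\cap\{\xi^0=1\}$ with its canonical orientation. Let $a_1,a_2,a_3\in\mathbb C$ satisfy $\operatorname{Re}a_j<0$ and $2(a_1+a_2+a_3)=1-d$, and let $\xi_1,\xi_2,\xi_3\in C^+$ lie on three distinct generatrices of the cone, i.e. $\xi_i\cdot\xi_j\neq0$ for $i\ne j$. Put $$F(\xi)=(\xi\cdot\xi_1)^{a_2+a_3}(\xi\cdot\xi_2)^{a_3+a_1}(\xi\cdot\xi_3)^{a_1+a_2}.$$ Then: 1. The integral of $F\alpha$ over $\gamma_0$ converges absolutely, and $$\int_{\gamma_0}F(\xi)\,\alpha(\xi)=d(a_1,a_2,a_3)\,(\xi_1\cdot\xi_2)^{a_3}(\xi_2\cdot\xi_3)^{a_1}(\xi_3\cdot\xi_1)^{a_2},$$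 $$d(a_1,a_2,a_3)=(2\pi)^{\frac{d-1}2}\,\frac{\Gamma(-a_1)\Gamma(-a_2)\Gamma(-a_3)}{\Gamma(-a_2-a_3)\Gamma(-a_3-a_1)\Gamma(-a_1-a_2)} .$$ 2. The integral does not depend on the cycle: $\int_\gamma F\alpha=\int_{\gamma_0}F\alpha$ for every smooth singular $(d-1)$-cycle $\gamma$ in $C^+$ that is homologous to $\gamma_0$ in $C^+$ and over which the integral converges absolutely. 3. The integral of $F$ with respect to the measure $|\alpha|$ converges absolutely and has the same value over every (not necessarily compact) $C^1$ basis of the cone, i.e. every $C^1$-parametrized hypersurface of $C^+$ that meets each generatrix at most once and almost every generatrix exactly once. In particular this holds for the parabolic basis $C^+\cap\{\xi^0+\xi^d=1\}=\{(\tfrac{1+\eta^2}2,\eta,\tfrac{1-\eta^2}2):\eta\in\mathbb R^{d-1}\}$ with the Lebesgue measure $d\eta$. 4. The integral is conformally invariant: replacing $(\xi_1,\xi_2,\xi_3)$ by $(\Lambda\xi_1,\Lambda\xi_2,\Lambda\xi_3)$ with $\Lambda\in SO_0(1,d)$, the group of Lorentz matrices with $\det\Lambda=1$ and $\Lambda^0{}_0>0$,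 does not change its value. -/

import Mathlib

open MeasureTheory Set
open scoped ContDiff

namespace LightCone

/-- The Lorentz product `x⁰y⁰ - x¹y¹ - ⋯ - x^d y^d` on `(d+1)`-dimensional Minkowski space. -/
def mdot {d : ℕ} (x y : Fin (d + 1) → ℝ) : ℝ :=
  x 0 * y 0 - ∑ i : Fin d, x i.succ * y i.succ

/-- The future light cone `C⁺ = {ξ : ξ·ξ = 0, ξ⁰ > 0}`. -/
def futureCone (d : ℕ) : Set (Fin (d + 1) → ℝ) :=
  {ξ | mdot ξ ξ = 0 ∧ 0 < ξ 0}

/-- The group `SO₀(1,d)` of proper orthochronous Lorentz matrices (as a predicate). -/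
def IsProperOrthochronous {d : ℕ} (L : Matrix (Fin (d + 1)) (Fin (d + 1)) ℝ) : Prop :=
  (∀ x y : Fin (d + 1) → ℝ, mdot (L.mulVec x) (L.mulVec y) = mdot x y) ∧ L.det = 1 ∧ 0 < L 0 0

/-- The `(d-1)`-form `α(ξ) = (ξ⁰)⁻¹ ∑_{j=1}^d (-1)^{j+1} ξ^j dξ¹ ∧ ⋯ ∧ (omit dξ^j) ∧ ⋯ ∧ dξ^d`,
evaluated on `n = d - 1` vectors. The index `j : Fin (n + 1)` stands for the coordinate `j + 1`. -/
noncomputable def coneForm {n : ℕ} (ξ : Fin (n + 1 + 1) → ℝ)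
    (v : Fin n → Fin (n + 1 + 1) → ℝ) : ℝ :=
  (ξ 0)⁻¹ * ∑ j : Fin (n + 1), (-1) ^ (j : ℕ) * ξ j.succ *
    (Matrix.of fun i k : Fin n => v i (j.succAbove k).succ).det

/-- The density at `t` of the pullback of `α` under a map `φ` defined on `S ⊆ ℝ^{d-1}`:
`α(φ(t))(∂₁φ(t), …, ∂_{d-1}φ(t))`. -/
noncomputable def pullbackDensity {n : ℕ} (φ : (Fin n → ℝ) → Fin (n + 1 + 1) → ℝ)
    (S : Set (Fin n → ℝ)) (t : Fin n → ℝ) : ℝ :=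
  coneForm (φ t) fun i => fderivWithin ℝ φ S t (Pi.single i 1)

/-! ### Smooth singular cubes and chains in the future cone -/

/-- Extension of a map on `[0,1]^k` to `ℝ^k` (by clamping the coordinates); only its restriction to
the closed cube is used. -/
noncomputable def cubeExtend {k : ℕ} {V : Type*} (f : (Fin k → unitInterval) → V) (t : Fin k → ℝ) : V :=
  f fun i => Set.projIcc 0 1 zero_le_one (t i)

/-- A smooth singular `k`-cube in the future cone `C⁺` of `(d+1)`-dimensional Minkowski space. -/
@[ext]
structure ConeCube (d k : ℕ) where
  toFun : (Fin k → unitInterval) → Fin (d + 1) → ℝ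
  smooth : ContDiffOn ℝ ∞ (cubeExtend toFun) (Icc 0 1)
  mem_cone : ∀ t, toFun t ∈ futureCone d

theorem cubeExtend_insertNth {k : ℕ} {V : Type*} (f : (Fin (k + 1) → unitInterval) → V)
    (i : Fin (k + 1)) (e : unitInterval) (t : Fin k → ℝ) :
    cubeExtend (fun s : Fin k → unitInterval => f (i.insertNth e s)) t
      = cubeExtend f (i.insertNth (α := fun _ => ℝ) (e : ℝ) t) := by
  unfold cubeExtend
  refine congrArg f (funext fun j => ?_)
  refine Fin.succAboveCases i ?_ (fun j => ?_) j
  · simp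
  · simp

/-- The face `t_i = e` of a cube, for `e = 0` or `e = 1`. -/
noncomputable def ConeCube.face {d k : ℕ} (σ : ConeCube d (k + 1)) (i : Fin (k + 1)) (e : unitInterval) :
    ConeCube d k where
  toFun s := σ.toFun (i.insertNth e s)
  smooth := by
    have h : cubeExtend (fun s : Fin k → unitInterval => σ.toFun (i.insertNth e s))
        = cubeExtend σ.toFun ∘ fun t => i.insertNth (α := fun _ => ℝ) (e : ℝ) t :=
      funext fun t => cubeExtend_insertNth σ.toFun i e t
    rw [h]
    refine σ.smooth.comp (ContDiff.contDiffOn ?_) ?_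
    · rw [contDiff_pi]
      intro j
      refine Fin.succAboveCases i ?_ (fun j => ?_) j
      · simpa using contDiff_const
      · simpa using contDiff_apply ℝ ℝ j
    · intro t ht
      constructor
      · intro j
        refine Fin.succAboveCases i ?_ (fun j => ?_) j
        · simpa using e.2.1
        · simpa using ht.1 j
      · intro j
        refine Fin.succAboveCases i ?_ (fun j => ?_) j
        · simpa using e.2.2
        · simpa using ht.2 j
  mem_cone s := σ.mem_cone _

/-- Smooth singular cubical `k`-chains in `C⁺` with integer coefficients. -/
abbrev ConeChain (d k : ℕ) : Type := ConeCube d k →₀ ℤ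

/-- The boundary `∂σ = ∑_i (-1)^i (σ|_{t_i=1} - σ|_{t_i=0})` (with `i` counted from `0`),
extended linearly to chains. -/
noncomputable def boundary {d k : ℕ} (b : ConeChain d (k + 1)) : ConeChain d k :=
  b.sum fun σ m => m • ∑ i : Fin (k + 1),
    (-1 : ℤ) ^ (i : ℕ) • (Finsupp.single (σ.face i 1) (1 : ℤ) - Finsupp.single (σ.face i 0) 1)

/-- A cube is degenerate if it does not depend on one of its coordinates. -/
def ConeCube.IsDegenerate {d k : ℕ} (σ : ConeCube d k) : Prop :=
  ∃ i : Fin k, ∀ (t : Fin k → unitInterval) (e : unitInterval), σ.toFun (Function.update t i e) = σ.toFun t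

/-- Two chains are homologous in `C⁺` if they differ by a boundary, modulo degenerate cubes
(as always for singular cubical homology). -/
def Homologous {d k : ℕ} (c c' : ConeChain d k) : Prop :=
  ∃ (b : ConeChain d (k + 1)) (e : ConeChain d k),
    (∀ σ ∈ e.support, σ.IsDegenerate) ∧ c = c' + boundary b + e

/-- The integral over the chain `c` of the form `F(ξ) α(ξ)` converges absolutely. -/
def ConvergesOn {n : ℕ} (F : (Fin (n + 1 + 1) → ℝ) → ℂ) (c : ConeChain (n + 1) n) : Prop :=
  ∀ σ ∈ c.support, IntegrableOn (fun t => F (cubeExtend σ.toFun t) *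
    (pullbackDensity (cubeExtend σ.toFun) (Icc 0 1) t : ℂ)) (Icc 0 1)

/-- The integral `∫_c F(ξ) α(ξ)` over the chain `c`. -/
noncomputable def chainIntegral {n : ℕ} (F : (Fin (n + 1 + 1) → ℝ) → ℂ)
    (c : ConeChain (n + 1) n) : ℂ :=
  c.sum fun σ m => (m : ℂ) * ∫ t in Icc (0 : Fin n → ℝ) 1, F (cubeExtend σ.toFun t) *
    (pullbackDensity (cubeExtend σ.toFun) (Icc 0 1) t : ℂ)

/-! ### The spherical cycle `γ₀` -/

/-- The `n = d - 1` spherical angles, `θ_i = π t_i` except for the last one, which is `2π t_i`. -/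
noncomputable def sphericalAngle {n : ℕ} (t : Fin n → ℝ) (i : Fin n) : ℝ :=
  if (i : ℕ) + 1 = n then 2 * Real.pi * t i else Real.pi * t i

/-- The point `(cos θ₁, sin θ₁ cos θ₂, …, sin θ₁ ⋯ sin θ_{n-1} cos θ_n, sin θ₁ ⋯ sin θ_n)` of the
unit sphere of `ℝ^{n+1}`. -/
noncomputable def sphericalCoord {n : ℕ} (θ : Fin n → ℝ) (j : Fin (n + 1)) : ℝ :=
  (∏ i : Fin n, if (i : ℕ) < j then Real.sin (θ i) else 1) *
    (if h : (j : ℕ) < n then Real.cos (θ ⟨j, h⟩) else 1)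

theorem sum_sq_sphericalCoord {n : ℕ} (θ : Fin n → ℝ) :
    ∑ j, sphericalCoord θ j * sphericalCoord θ j = 1 := by
  induction n with
  | zero => simp [sphericalCoord]
  | succ n ih =>
    rw [Fin.sum_univ_succ]
    have h0 : sphericalCoord θ 0 = Real.cos (θ 0) := by
      simp [sphericalCoord]
    have hs : ∀ j : Fin (n + 1), sphericalCoord θ j.succ
        = Real.sin (θ 0) * sphericalCoord (fun i => θ i.succ) j := by
      intro j
      unfold sphericalCoord
      rw [Fin.prod_univ_succ]
      simp [mul_assoc]
    have h2 := ih fun i => θ i.succ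
    have h3 : ∑ j : Fin (n + 1), sphericalCoord θ j.succ * sphericalCoord θ j.succ
        = Real.sin (θ 0) ^ 2 := by
      calc _ = ∑ j : Fin (n + 1), Real.sin (θ 0) ^ 2 *
            (sphericalCoord (fun i => θ i.succ) j * sphericalCoord (fun i => θ i.succ) j) := by
            refine Finset.sum_congr rfl fun j _ => ?_
            rw [hs]; ring
        _ = _ := by rw [← Finset.mul_sum, h2, mul_one]
    rw [h0, h3]
    nlinarith [Real.sin_sq_add_cos_sq (θ 0)]

/-- The point `(1, n)` of the cone over the point `n` of the unit sphere with parameters `t`. -/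
noncomputable def spherePoint {n : ℕ} (t : Fin n → ℝ) : Fin (n + 1 + 1) → ℝ :=
  Fin.cons 1 (sphericalCoord (sphericalAngle t))

/-- The unit sphere `C⁺ ∩ {ξ⁰ = 1}` as a smooth singular cube, through spherical coordinates. -/
noncomputable def sphereCube (n : ℕ) : ConeCube (n + 1) n where
  toFun t := spherePoint fun i => (t i : ℝ)
  smooth := by
    have h : ContDiff ℝ ∞ (spherePoint (n := n)) := by
      rw [contDiff_pi]
      intro j
      refine Fin.cases ?_ (fun j => ?_) j
      · simpa [spherePoint] using contDiff_const
      · have ha : ∀ i : Fin n, ContDiff ℝ ∞ fun t : Fin n → ℝ => sphericalAngle t i := by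
          intro i
          unfold sphericalAngle
          split_ifs
          · exact contDiff_const.mul (contDiff_apply ℝ ℝ i)
          · exact contDiff_const.mul (contDiff_apply ℝ ℝ i)
        simp only [spherePoint, Fin.cons_succ, sphericalCoord]
        refine ContDiff.mul (contDiff_prod fun i _ => ?_) ?_
        · split_ifs
          · exact (ha i).sin
          · exact contDiff_const
        · split_ifs
          · exact (ha _).cos
          · exact contDiff_const
    refine h.contDiffOn.congr fun t ht => ?_
    unfold cubeExtend
    refine congrArg spherePoint (funext fun i => ?_)
    exact congrArg Subtype.val (Set.projIcc_of_mem zero_le_one ⟨ht.1 i, ht.2 i⟩)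
  mem_cone t := by
    refine ⟨?_, ?_⟩
    · simp [mdot, spherePoint, sum_sq_sphericalCoord]
    · simp [spherePoint]

/-- The cycle `γ₀`: the unit sphere `C⁺ ∩ {ξ⁰ = 1}` with its canonical orientation. -/
noncomputable def sphereCycle (n : ℕ) : ConeChain (n + 1) n :=
  Finsupp.single (sphereCube n) 1

/-! ### Bases (sections) of the cone, not necessarily compact -/

/-- `φ : U → C⁺`, with `U ⊆ ℝ^{d-1}` open, is a `C¹` parametrization of a basis of the cone:
a hypersurface that meets each generatrix of the cone at most once, and almost every generatrix
(the one through `(|x|, x)`, for almost every `x ∈ ℝ^d`) exactly once. -/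
structure IsConeBase {n : ℕ} (U : Set (Fin n → ℝ)) (φ : (Fin n → ℝ) → Fin (n + 1 + 1) → ℝ) :
    Prop where
  isOpen : IsOpen U
  contDiffOn : ContDiffOn ℝ 1 φ U
  mem_cone : ∀ u ∈ U, φ u ∈ futureCone (n + 1)
  inj : ∀ u ∈ U, ∀ v ∈ U, ∀ r : ℝ, 0 < r → φ u = r • φ v → u = v
  covers : ∀ᵐ x : Fin (n + 1) → ℝ, ∃ u ∈ U, ∃ r : ℝ, 0 < r ∧ ∀ i, φ u i.succ = r * x i

/-- The points `((1 + η²)/2, η, (1 - η²)/2)`, `η ∈ ℝ^{d-1}`, of the parabolic basis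
`C⁺ ∩ {ξ⁰ + ξ^d = 1}`. -/
noncomputable def parabolicPoint {n : ℕ} (η : Fin n → ℝ) : Fin (n + 1 + 1) → ℝ :=
  Fin.cons ((1 + ∑ i, η i ^ 2) / 2)
    (Fin.snoc (α := fun _ => ℝ) η ((1 - ∑ i, η i ^ 2) / 2))

/-! ### The star-triangle integrand and constant -/

/-- `(ξ·ξ₁)^{a₂+a₃} (ξ·ξ₂)^{a₃+a₁} (ξ·ξ₃)^{a₁+a₂}`. -/
noncomputable def starIntegrand {d : ℕ} (a₁ a₂ a₃ : ℂ) (ξ₁ ξ₂ ξ₃ ξ : Fin (d + 1) → ℝ) : ℂ :=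
  (mdot ξ ξ₁ : ℂ) ^ (a₂ + a₃) * (mdot ξ ξ₂ : ℂ) ^ (a₃ + a₁) * (mdot ξ ξ₃ : ℂ) ^ (a₁ + a₂)

/-- `d(a₁,a₂,a₃) = (2π)^{(d-1)/2} Γ(-a₁)Γ(-a₂)Γ(-a₃) / [Γ(-a₂-a₃)Γ(-a₃-a₁)Γ(-a₁-a₂)]`. -/
noncomputable def starConst (d : ℕ) (a₁ a₂ a₃ : ℂ) : ℂ :=
  (2 * Real.pi : ℂ) ^ (((d : ℂ) - 1) / 2) *
    (Complex.Gamma (-a₁) * Complex.Gamma (-a₂) * Complex.Gamma (-a₃)) /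
    (Complex.Gamma (-a₂ - a₃) * Complex.Gamma (-a₃ - a₁) * Complex.Gamma (-a₁ - a₂))

end LightCone

namespace LightCone

/-! Write `n = d - 1`. The condition on the `aⱼ` makes `F` homogeneous of degree `-n`, and
everything rests on that.

Independence of the basis. A basis `φ : U → C⁺` yields polar coordinates `(r, u) ↦ r φ(u)` (spatial
part) on almost all of `ℝ^d`, with Jacobian `r^n φ⁰(u)` times the density of `α`. Integrating
`F(|x|, x) exp(-|x|)` over `ℝ^d` in these coordinates, the powers of `r` cancel, the radial integral
`∫ φ⁰ exp(-r φ⁰) dr` equals 1, and the integral of `F |α|` over the basis remains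
(`IsConeBase.integral_eq`). All bases therefore share one value. Spherical coordinates are
positively oriented, so the cycle `γ₀` has this value too.

The value is computed on the parabolic basis. Feynman parameters write `F(ξ)` as a multiple of the
integral over `s, t > 0` of powers of `s` and `t` times `(ξ·P)^{-n}`, where `P = ξ₁ + sξ₂ + tξ₃`
(`feynman_three`). Since `P` is timelike, a Gaussian computation gives `∫ (ξ·P)^{-n} dη = C
(P·P/2)^{-n/2}` (`integral_mdot_parabolicPoint_rpow`). The `ξᵢ` being null, `P·P/2 = s ξ₁·ξ₂ + t
ξ₃·ξ₁ + st ξ₂·ξ₃`, and two Euler beta integrals finish (`integral_starKernel`). The answer involves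
the `ξᵢ` only through their Lorentz products, hence the invariance under `SO₀(1,d)`.

Independence of the cycle. In the coordinate `x` of `ℝ^d ∖ {0}`, `F α` is the flux form of a radial
field with density homogeneous of degree `-(n+1)`; by Euler's identity it is closed wherever it is
differentiable (`extDeriv_fluxForm`), so Stokes applies. As `F` may be singular along the
generatrices of the `ξᵢ`, it is first multiplied by smooth cutoffs homogeneous of degree 0, which
keep the form closed; dominated convergence removes them. -/

/-! ### Points of the cone, Lorentz products, homogeneity of the integrand. -/

/-- The point of the future cone over a nonzero `x`. -/
noncomputable def coneLift {d : ℕ} (x : Fin d → ℝ) : Fin (d + 1) → ℝ :=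
  Fin.cons (√(∑ j, x j ^ 2)) x

/-- The spatial part of a vector of Minkowski space. -/
def spatial {d : ℕ} (ξ : Fin (d + 1) → ℝ) : Fin d → ℝ := fun j => ξ j.succ

@[simp] theorem coneLift_zero {d : ℕ} (x : Fin d → ℝ) : coneLift x 0 = √(∑ j, x j ^ 2) := rfl

@[simp] theorem coneLift_succ {d : ℕ} (x : Fin d → ℝ) (j : Fin d) : coneLift x j.succ = x j := rfl

@[simp] theorem spatial_coneLift {d : ℕ} (x : Fin d → ℝ) : spatial (coneLift x) = x := rfl

theorem sum_sq_spatial {d : ℕ} {ξ : Fin (d + 1) → ℝ} (hξ : ξ ∈ futureCone d) :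
    ∑ j, spatial ξ j ^ 2 = ξ 0 ^ 2 := by
  have h := hξ.1
  simp only [mdot] at h
  simp only [spatial, sq]
  linarith

theorem coneLift_spatial {d : ℕ} {ξ : Fin (d + 1) → ℝ} (hξ : ξ ∈ futureCone d) :
    coneLift (spatial ξ) = ξ := by
  funext j
  refine Fin.cases ?_ (fun j => rfl) j
  rw [coneLift_zero, sum_sq_spatial hξ, Real.sqrt_sq hξ.2.le]

theorem sum_sq_pos {ι : Type*} [Fintype ι] {x : ι → ℝ} (hx : x ≠ 0) : 0 < ∑ j, x j ^ 2 := by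
  obtain ⟨j, hj⟩ := Function.ne_iff.1 hx
  exact Finset.sum_pos' (fun i _ => sq_nonneg _) ⟨j, Finset.mem_univ _, by simpa using sq_pos_of_ne_zero hj⟩

theorem spatial_ne_zero {d : ℕ} {ξ : Fin (d + 1) → ℝ} (hξ : ξ ∈ futureCone d) :
    spatial ξ ≠ 0 := by
  intro h
  have h1 := sum_sq_spatial hξ
  have h2 := hξ.2
  simp [h] at h1
  nlinarith

theorem coneLift_mem {d : ℕ} {x : Fin d → ℝ} (hx : x ≠ 0) : coneLift x ∈ futureCone d := by
  have h := sum_sq_pos hx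
  refine ⟨?_, Real.sqrt_pos.2 h⟩
  simp only [mdot, coneLift_zero, coneLift_succ]
  rw [Real.mul_self_sqrt h.le]
  simp [sq]

theorem coneLift_smul {d : ℕ} {r : ℝ} (hr : 0 ≤ r) (x : Fin d → ℝ) :
    coneLift (r • x) = r • coneLift x := by
  funext j
  refine Fin.cases ?_ (fun j => rfl) j
  simp only [coneLift_zero, Pi.smul_apply, smul_eq_mul, mul_pow]
  rw [← Finset.mul_sum, Real.sqrt_mul (sq_nonneg r), Real.sqrt_sq hr]

theorem mdot_comm {d : ℕ} (x y : Fin (d + 1) → ℝ) : mdot x y = mdot y x := by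
  simp [mdot, mul_comm]

theorem mdot_smul_left {d : ℕ} (r : ℝ) (x y : Fin (d + 1) → ℝ) :
    mdot (r • x) y = r * mdot x y := by
  simp [mdot, mul_sub, Finset.mul_sum, mul_assoc]

theorem mdot_add_left {d : ℕ} (x y z : Fin (d + 1) → ℝ) :
    mdot (x + y) z = mdot x z + mdot y z := by
  simp only [mdot, Pi.add_apply, add_mul, Finset.sum_add_distrib]
  ring

theorem mdot_smul_right {d : ℕ} (r : ℝ) (x y : Fin (d + 1) → ℝ) :
    mdot x (r • y) = r * mdot x y := by
  rw [mdot_comm, mdot_smul_left, mdot_comm]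

theorem mdot_add_right {d : ℕ} (x y z : Fin (d + 1) → ℝ) :
    mdot x (y + z) = mdot x y + mdot x z := by
  rw [mdot_comm, mdot_add_left, mdot_comm y, mdot_comm z]

/-- Cauchy–Schwarz on the spatial parts. Causal rather than null vectors are allowed because the
image of the time axis under a Lorentz matrix is needed later. -/
theorem mdot_nonneg_of_sum_sq_le {d : ℕ} {x y : Fin (d + 1) → ℝ} (hx0 : 0 ≤ x 0) (hy0 : 0 ≤ y 0)
    (hx : ∑ j, spatial x j ^ 2 ≤ x 0 ^ 2) (hy : ∑ j, spatial y j ^ 2 ≤ y 0 ^ 2) :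
    0 ≤ mdot x y := by
  have h := Finset.sum_mul_sq_le_sq_mul_sq Finset.univ (spatial x) (spatial y)
  have h2 : (∑ j, spatial x j * spatial y j) ^ 2 ≤ (x 0 * y 0) ^ 2 := by
    rw [mul_pow]
    exact h.trans (mul_le_mul hx hy (Finset.sum_nonneg fun _ _ => sq_nonneg _) (sq_nonneg _))
  have h3 := le_of_abs_le (abs_le_of_sq_le_sq h2 (mul_nonneg hx0 hy0))
  simp only [mdot]
  simp only [spatial] at h3
  linarith

theorem mdot_nonneg {d : ℕ} {x y : Fin (d + 1) → ℝ} (hx : x ∈ futureCone d)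
    (hy : y ∈ futureCone d) : 0 ≤ mdot x y :=
  mdot_nonneg_of_sum_sq_le hx.2.le hy.2.le (sum_sq_spatial hx).le (sum_sq_spatial hy).le

theorem contDiff_mdot_left {d : ℕ} (y : Fin (d + 1) → ℝ) {k : ℕ∞} :
    ContDiff ℝ k fun x : Fin (d + 1) → ℝ => mdot x y := by
  unfold mdot
  fun_prop

/-- The vectors `x, v₁, …, v_n` as the rows of a matrix. -/
def rows {n : ℕ} (x : Fin (n + 1) → ℝ) (v : Fin n → Fin (n + 1) → ℝ) :
    Matrix (Fin (n + 1)) (Fin (n + 1)) ℝ := Matrix.of (Fin.cons x v)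

/-- The sum defining `α` is a Laplace expansion along the first row: `α` is the Euclidean volume
form contracted with the radial vector, divided by `ξ⁰`. -/
theorem coneForm_eq_det {n : ℕ} (ξ : Fin (n + 1 + 1) → ℝ) (v : Fin n → Fin (n + 1 + 1) → ℝ) :
    coneForm ξ v = (ξ 0)⁻¹ * (rows (spatial ξ) fun i => spatial (v i)).det := by
  rw [Matrix.det_succ_row_zero]
  rfl

theorem measurable_starIntegrand {d : ℕ} (a₁ a₂ a₃ : ℂ) (ξ₁ ξ₂ ξ₃ : Fin (d + 1) → ℝ) :
    Measurable (starIntegrand a₁ a₂ a₃ ξ₁ ξ₂ ξ₃) := by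
  unfold starIntegrand
  have h : ∀ y : Fin (d + 1) → ℝ, Measurable fun x : Fin (d + 1) → ℝ => (mdot x y : ℂ) :=
    fun y => Complex.measurable_ofReal.comp (contDiff_mdot_left y (k := 0)).continuous.measurable
  exact (((h _).pow_const _).mul ((h _).pow_const _)).mul ((h _).pow_const _)

theorem starIntegrand_smul {n : ℕ} {a₁ a₂ a₃ : ℂ}
    (hsum : 2 * (a₁ + a₂ + a₃) = 1 - ((n + 1 : ℕ) : ℂ)) (ξ₁ ξ₂ ξ₃ ξ : Fin (n + 1 + 1) → ℝ)
    {r : ℝ} (hr : 0 < r) :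
    starIntegrand a₁ a₂ a₃ ξ₁ ξ₂ ξ₃ (r • ξ) =
      ((r ^ n)⁻¹ : ℝ) * starIntegrand a₁ a₂ a₃ ξ₁ ξ₂ ξ₃ ξ := by
  have hrc : (r : ℂ) ≠ 0 := by exact_mod_cast hr.ne'
  have h1 : (((r ^ n)⁻¹ : ℝ) : ℂ) = (r : ℂ) ^ (a₂ + a₃) * (r : ℂ) ^ (a₃ + a₁) * (r : ℂ) ^ (a₁ + a₂) := by
    rw [← Complex.cpow_add _ _ hrc, ← Complex.cpow_add _ _ hrc]
    have : a₂ + a₃ + (a₃ + a₁) + (a₁ + a₂) = -(n : ℂ) := by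
      push_cast at hsum; linear_combination hsum
    rw [this, Complex.cpow_neg, Complex.cpow_natCast]
    push_cast; rfl
  have h2 : ∀ (y : Fin (n + 1 + 1) → ℝ) (b : ℂ),
      (mdot (r • ξ) y : ℂ) ^ b = (r : ℂ) ^ b * (mdot ξ y : ℂ) ^ b := by
    intro y b
    rw [mdot_smul_left, Complex.ofReal_mul]
    rcases le_or_gt 0 (mdot ξ y) with h | h
    · exact Complex.mul_cpow_ofReal_nonneg hr.le h b
    -- A positive factor does not change the argument, so the principal power stays multiplicative
    -- on negative reals and no condition on `ξ` is needed.
    · have hz : (mdot ξ y : ℂ) ≠ 0 := by exact_mod_cast h.ne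
      rw [Complex.cpow_def_of_ne_zero (mul_ne_zero hrc hz), Complex.cpow_def_of_ne_zero hrc,
        Complex.cpow_def_of_ne_zero hz, Complex.log_ofReal_mul hr hz, Complex.ofReal_log hr.le,
        add_mul, Complex.exp_add]
  simp only [starIntegrand, h2, h1]
  ring

/-! ### Euler beta integrals on the half-line. -/

theorem ofReal_cpow_eq_exp {p : ℝ} (hp : 0 < p) (z : ℂ) :
    (p : ℂ) ^ z = Complex.exp ((Real.log p : ℂ) * z) := by
  rw [Complex.cpow_def_of_ne_zero (by exact_mod_cast hp.ne'), Complex.ofReal_log hp.le]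

theorem image_mul_div_one_sub {a : ℝ} (ha : 0 < a) :
    (fun x : ℝ => a * x / (1 - x)) '' Ioo 0 1 = Ioi 0 := by
  ext s
  constructor
  · rintro ⟨x, hx, rfl⟩
    exact div_pos (mul_pos ha hx.1) (by linarith [hx.2])
  · intro hs
    have hs : 0 < s := hs
    refine ⟨s / (a + s), ⟨by positivity, by rw [div_lt_one (by positivity)]; linarith⟩, ?_⟩
    have : a + s ≠ 0 := by positivity
    have h2 : 1 - s / (a + s) = a / (a + s) := by field_simp; ring
    simp only [h2]
    field_simp

/-- The substitution `s = (Y/X) x/(1-x)` turns `Y + sX` into `Y/(1-x)`; the leading factor is its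
Jacobian. All bases are positive, so every power is an exponential of a real logarithm and the
identity is linear in the logarithms. -/
theorem beta_kernel_comp {X Y : ℝ} (hX : 0 < X) (hY : 0 < Y) (β ν : ℂ) {x : ℝ}
    (hx : x ∈ Ioo (0 : ℝ) 1) :
    |Y / X / (1 - x) ^ 2| • (((Y / X * x / (1 - x) : ℝ) : ℂ) ^ (β - 1) *
      ((Y + Y / X * x / (1 - x) * X : ℝ) : ℂ) ^ (-ν)) =
    (X : ℂ) ^ (-β) * (Y : ℂ) ^ (β - ν) * ((x : ℂ) ^ (β - 1) * (1 - (x : ℂ)) ^ (ν - β - 1)) := by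
  have h1 : 0 < 1 - x := by linarith [hx.2]
  have h0 : 0 < x := hx.1
  have e1 : Y + Y / X * x / (1 - x) * X = Y / (1 - x) := by field_simp; ring
  have e2 : (1 : ℂ) - x = ((1 - x : ℝ) : ℂ) := by push_cast; rfl
  have e3 : 0 < Y / X / (1 - x) ^ 2 := by positivity
  have e4 : ((Y / X / (1 - x) ^ 2 : ℝ) : ℂ) = ((Y / X / (1 - x) ^ 2 : ℝ) : ℂ) ^ (1 : ℂ) := by
    rw [Complex.cpow_one]
  rw [e1, abs_of_pos e3, e2, Complex.real_smul, e4, ofReal_cpow_eq_exp e3,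
    ofReal_cpow_eq_exp (by positivity), ofReal_cpow_eq_exp (by positivity), ofReal_cpow_eq_exp hX,
    ofReal_cpow_eq_exp hY, ofReal_cpow_eq_exp h0, ofReal_cpow_eq_exp h1]
  simp only [← Complex.exp_add]
  congr 1
  rw [Real.log_div (by positivity) (by positivity), Real.log_div (by positivity) (by positivity),
    Real.log_div (x := Y / X * x) (by positivity) (by positivity),
    Real.log_mul (by positivity) (by positivity), Real.log_div (by positivity) (by positivity),
    Real.log_div (by positivity) (by positivity), Real.log_pow]
  push_cast
  ring

/-- The Euler beta integral in the form `∫₀^∞ s^{β-1} (Y + sX)^{-ν} ds`. -/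
theorem integral_beta_Ioi {X Y : ℝ} (hX : 0 < X) (hY : 0 < Y) {β ν : ℂ} (hβ : 0 < β.re)
    (hν : β.re < ν.re) :
    IntegrableOn (fun s : ℝ => (s : ℂ) ^ (β - 1) * ((Y + s * X : ℝ) : ℂ) ^ (-ν)) (Ioi 0) ∧
    ∫ s in Ioi (0 : ℝ), (s : ℂ) ^ (β - 1) * ((Y + s * X : ℝ) : ℂ) ^ (-ν) =
      (X : ℂ) ^ (-β) * (Y : ℂ) ^ (β - ν) *
        (Complex.Gamma β * Complex.Gamma (ν - β) / Complex.Gamma ν) := by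
  have hνβ : 0 < (ν - β).re := by simpa using hν
  have hd : ∀ x ∈ Ioo (0 : ℝ) 1, HasDerivWithinAt (fun x : ℝ => Y / X * x / (1 - x))
      (Y / X / (1 - x) ^ 2) (Ioo 0 1) x := by
    intro x hx
    have h1 : 1 - x ≠ 0 := by linarith [hx.2]
    have := (((hasDerivAt_id x).const_mul (Y / X)).div ((hasDerivAt_id x).const_sub 1) h1)
    refine (this.congr_deriv ?_).hasDerivWithinAt
    simp only [id]
    field_simp
    ring
  have hinj : InjOn (fun x : ℝ => Y / X * x / (1 - x)) (Ioo 0 1) := by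
    intro x hx y hy h
    have h1 : 1 - x ≠ 0 := by linarith [hx.2]
    have h2 : 1 - y ≠ 0 := by linarith [hy.2]
    simp only at h
    field_simp at h
    linarith
  have hc := fun x (hx : x ∈ Ioo (0 : ℝ) 1) => beta_kernel_comp hX hY β ν hx
  have hconv := Complex.betaIntegral_convergent hβ hνβ
  rw [intervalIntegrable_iff_integrableOn_Ioo_of_le zero_le_one] at hconv
  have hbeta := Complex.betaIntegral_eq_Gamma_mul_div β (ν - β) hβ hνβ
  rw [Complex.betaIntegral, intervalIntegral.integral_of_le zero_le_one,
    integral_Ioc_eq_integral_Ioo, add_sub_cancel] at hbeta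
  rw [← image_mul_div_one_sub (div_pos hY hX)]
  constructor
  · rw [integrableOn_image_iff_integrableOn_abs_deriv_smul measurableSet_Ioo hd hinj]
    exact IntegrableOn.congr_fun (hconv.const_mul _) (fun x hx => (hc x hx).symm) measurableSet_Ioo
  · rw [integral_image_eq_integral_abs_deriv_smul measurableSet_Ioo hd hinj,
      setIntegral_congr_fun measurableSet_Ioo hc, integral_const_mul, hbeta]

/-- The version for real exponents evaluates integrals of norms. -/
theorem integral_beta_Ioi_real {X Y : ℝ} (hX : 0 < X) (hY : 0 < Y) {b v : ℝ} (hb : 0 < b)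
    (hv : b < v) :
    ∫ s in Ioi (0 : ℝ), s ^ (b - 1) * (Y + s * X) ^ (-v) =
      X ^ (-b) * Y ^ (b - v) * (Real.Gamma b * Real.Gamma (v - b) / Real.Gamma v) := by
  have h := (integral_beta_Ioi hX hY (β := b) (ν := v) (by simpa) (by simpa)).2
  have h1 : ∀ s ∈ Ioi (0 : ℝ), (s : ℂ) ^ ((b : ℂ) - 1) * ((Y + s * X : ℝ) : ℂ) ^ (-(v : ℂ)) =
      ((s ^ (b - 1) * (Y + s * X) ^ (-v) : ℝ) : ℂ) := by
    intro s (hs : 0 < s)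
    rw [Complex.ofReal_mul, Complex.ofReal_cpow hs.le, Complex.ofReal_cpow (by positivity)]
    push_cast
    rfl
  rw [setIntegral_congr_fun measurableSet_Ioi h1, integral_complex_ofReal] at h
  rw [← Complex.ofReal_inj, h]
  push_cast [Complex.ofReal_cpow hX.le, Complex.ofReal_cpow hY.le, Complex.Gamma_ofReal]
  rw [← Complex.ofReal_sub v b, Complex.Gamma_ofReal]

/-! ### The invariant integral over the parabolic basis. -/

/-- The Lorentz product with the points of the parabolic basis, as a quadratic polynomial. -/
theorem mdot_parabolicPoint {n : ℕ} (η : Fin n → ℝ) (P : Fin (n + 1 + 1) → ℝ) :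
    mdot (parabolicPoint η) P =
      (P 0 + P (Fin.last n).succ) / 2 * ∑ i, η i ^ 2 - ∑ i : Fin n, P i.castSucc.succ * η i +
        (P 0 - P (Fin.last n).succ) / 2 := by
  simp only [mdot, parabolicPoint, Fin.cons_zero, Fin.cons_succ, Fin.sum_univ_castSucc,
    Fin.snoc_castSucc, Fin.snoc_last]
  simp only [mul_comm (η _)]
  ring

theorem mdot_self_eq {n : ℕ} (P : Fin (n + 1 + 1) → ℝ) :
    mdot P P = (P 0 + P (Fin.last n).succ) * (P 0 - P (Fin.last n).succ) -
      ∑ i : Fin n, P i.castSucc.succ ^ 2 := by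
  simp only [mdot, Fin.sum_univ_castSucc, sq]
  ring

theorem parabolicPoint_mem {n : ℕ} (η : Fin n → ℝ) : parabolicPoint η ∈ futureCone (n + 1) := by
  have h : 0 ≤ ∑ i, η i ^ 2 := Finset.sum_nonneg fun _ _ => sq_nonneg _
  refine ⟨?_, ?_⟩
  · rw [mdot_self_eq]
    simp only [parabolicPoint, Fin.cons_zero, Fin.cons_succ, Fin.snoc_castSucc, Fin.snoc_last]
    ring
  · simp only [parabolicPoint, Fin.cons_zero]
    positivity

theorem integral_gaussian_quadratic {n : ℕ} {b : ℝ} (hb : 0 < b) (c : Fin n → ℝ) :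
    Integrable (fun η : Fin n → ℝ => Real.exp (-b * ∑ i, η i ^ 2 + ∑ i, c i * η i)) ∧
    ∫ η : Fin n → ℝ, Real.exp (-b * ∑ i, η i ^ 2 + ∑ i, c i * η i) =
      (Real.pi / b) ^ ((n : ℝ) / 2) * Real.exp ((∑ i, c i ^ 2) / (4 * b)) := by
  have hb' : 0 < (b : ℂ).re := by simpa
  have h := GaussianFourier.integral_cexp_neg_mul_sum_add (ι := Fin n) hb' (fun i => (c i : ℂ))
  have h1 : ∀ η : Fin n → ℝ, Complex.exp (-(b : ℂ) * ∑ i, (η i : ℂ) ^ 2 + ∑ i, (c i : ℂ) * η i) =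
      ((Real.exp (-b * ∑ i, η i ^ 2 + ∑ i, c i * η i) : ℝ) : ℂ) := by
    intro η
    push_cast
    rfl
  simp only [h1] at h
  rw [integral_complex_ofReal] at h
  have h2 : ∫ η : Fin n → ℝ, Real.exp (-b * ∑ i, η i ^ 2 + ∑ i, c i * η i) =
      (Real.pi / b) ^ ((n : ℝ) / 2) * Real.exp ((∑ i, c i ^ 2) / (4 * b)) := by
    rw [← Complex.ofReal_inj, h, Complex.ofReal_mul,
      Complex.ofReal_cpow (div_nonneg Real.pi_pos.le hb.le)]
    push_cast
    simp
  -- The Bochner integral of a non-integrable function is 0, so a nonzero value proves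
  -- integrability.
  refine ⟨Integrable.of_integral_ne_zero ?_, h2⟩
  rw [h2]
  positivity

theorem integral_rpow_mul_exp {a r : ℝ} (ha : 0 < a) (hr : 0 < r) :
    IntegrableOn (fun t : ℝ => t ^ (a - 1) * Real.exp (-(r * t))) (Ioi 0) ∧
    ∫ t in Ioi (0 : ℝ), t ^ (a - 1) * Real.exp (-(r * t)) = r ^ (-a) * Real.Gamma a := by
  have h := Real.integral_rpow_mul_exp_neg_mul_Ioi ha hr
  rw [one_div, Real.inv_rpow hr.le, ← Real.rpow_neg hr.le] at h
  refine ⟨Integrable.of_integral_ne_zero ?_, h⟩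
  rw [h]
  have := Real.Gamma_pos_of_pos ha
  positivity

/-- The Lorentz-invariant integral `∫ (ξ·P)^{-(d-1)} dη` over the parabolic basis, for `P` in the
open future cone. -/
theorem integral_mdot_parabolicPoint_rpow {n : ℕ} (hn : 1 ≤ n) {P : Fin (n + 1 + 1) → ℝ}
    (hB : 0 < P 0 + P (Fin.last n).succ) (hP : 0 < mdot P P) :
    (∀ η : Fin n → ℝ, 0 < mdot (parabolicPoint η) P) ∧
    Integrable (fun η : Fin n → ℝ => mdot (parabolicPoint η) P ^ (-(n : ℝ))) ∧
    ∫ η : Fin n → ℝ, mdot (parabolicPoint η) P ^ (-(n : ℝ)) =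
      (2 * Real.pi) ^ ((n : ℝ) / 2) * Real.Gamma ((n : ℝ) / 2) / Real.Gamma n *
        (mdot P P / 2) ^ (-((n : ℝ) / 2)) := by
  have hn0 : (0 : ℝ) < n := by exact_mod_cast hn
  set B := P 0 + P (Fin.last n).succ with hBdef
  set X : (Fin n → ℝ) → ℝ := fun η => mdot (parabolicPoint η) P with hX
  have hXpos : ∀ η, 0 < X η := by
    intro η
    -- Completing the square in `η`.
    have h1 : 2 * B * X η = ∑ i, (B * η i - P i.castSucc.succ) ^ 2 + mdot P P := by
      simp only [hX, mdot_parabolicPoint, mdot_self_eq, ← hBdef]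
      have : ∑ i, (B * η i - P i.castSucc.succ) ^ 2 = B ^ 2 * ∑ i, η i ^ 2 -
          2 * B * ∑ i, P i.castSucc.succ * η i + ∑ i : Fin n, P i.castSucc.succ ^ 2 := by
        simp only [Finset.mul_sum, ← Finset.sum_sub_distrib, ← Finset.sum_add_distrib]
        exact Finset.sum_congr rfl fun i _ => by ring
      rw [this]
      ring
    have h2 : 0 < 2 * B * X η := by
      rw [h1]
      exact add_pos_of_nonneg_of_pos (Finset.sum_nonneg fun _ _ => sq_nonneg _) hP
    exact pos_of_mul_pos_right h2 (by positivity)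
  have hXm : Measurable X := by
    simp only [hX, mdot_parabolicPoint]
    fun_prop
  -- Integrating `K` over `t` gives `Γ(n) X^{-n}`; integrating over `η` first gives a Gaussian and
  -- then a Gamma integral with parameter `n/2`. The value comes from comparing the two orders.
  set K : (Fin n → ℝ) × ℝ → ℝ := fun z => z.2 ^ ((n : ℝ) - 1) * Real.exp (-(X z.1 * z.2)) with hK
  have hKm : Measurable K := by
    have : Measurable fun z : (Fin n → ℝ) × ℝ => X z.1 := hXm.comp measurable_fst
    simp only [hK]
    refine (measurable_snd.pow_const _).mul ?_
    exact Real.measurable_exp.comp (this.mul measurable_snd).neg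
  have hinner : ∀ t ∈ Ioi (0 : ℝ), Integrable (fun η => K (η, t)) ∧ ∫ η, K (η, t) =
      (2 * Real.pi / B) ^ ((n : ℝ) / 2) *
        (t ^ ((n : ℝ) / 2 - 1) * Real.exp (-(mdot P P / 2 / B * t))) := by
    intro t (ht : 0 < t)
    have hb : 0 < t * B / 2 := by positivity
    have hg := integral_gaussian_quadratic hb (fun i : Fin n => t * P i.castSucc.succ)
    have e1 : ∀ η, K (η, t) = t ^ ((n : ℝ) - 1) *
        Real.exp (-(t * ((P 0 - P (Fin.last n).succ) / 2))) *
        Real.exp (-(t * B / 2) * ∑ i, η i ^ 2 + ∑ i : Fin n, t * P i.castSucc.succ * η i) := by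
      intro η
      simp only [hK, hX, mdot_parabolicPoint, ← hBdef]
      rw [mul_assoc, ← Real.exp_add]
      congr 2
      simp only [mul_assoc, ← Finset.mul_sum]
      ring
    simp only [e1]
    refine ⟨hg.1.const_mul _, ?_⟩
    rw [integral_const_mul, hg.2]
    have e2 : (Real.pi / (t * B / 2)) ^ ((n : ℝ) / 2) =
        (2 * Real.pi / B) ^ ((n : ℝ) / 2) * t ^ (-((n : ℝ) / 2)) := by
      rw [Real.rpow_neg ht.le, ← Real.inv_rpow ht.le, ← Real.mul_rpow (by positivity) (by positivity)]
      congr 1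
      field_simp
    have e3 : t ^ ((n : ℝ) / 2 - 1) = t ^ ((n : ℝ) - 1) * t ^ (-((n : ℝ) / 2)) := by
      rw [← Real.rpow_add ht]
      congr 1
      ring
    have e4 : Real.exp (-(mdot P P / 2 / B * t)) =
        Real.exp (-(t * ((P 0 - P (Fin.last n).succ) / 2))) *
          Real.exp ((∑ i : Fin n, (t * P i.castSucc.succ) ^ 2) / (4 * (t * B / 2))) := by
      rw [← Real.exp_add]
      congr 1
      simp only [mul_pow, ← Finset.mul_sum]
      rw [mdot_self_eq, ← hBdef]
      field_simp
      ring
    rw [e2, e3, e4]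
    ring
  have hKn : ∀ η, ∀ t ∈ Ioi (0 : ℝ), ‖K (η, t)‖ = K (η, t) := fun η t (ht : 0 < t) =>
    Real.norm_of_nonneg (by positivity)
  have hout := integral_rpow_mul_exp (a := (n : ℝ) / 2) (r := mdot P P / 2 / B)
    (by positivity) (by positivity)
  have hKi : Integrable K (volume.prod (volume.restrict (Ioi 0))) := by
    rw [integrable_prod_iff' hKm.aestronglyMeasurable]
    refine ⟨(ae_restrict_iff' measurableSet_Ioi).2 (.of_forall fun t ht => (hinner t ht).1), ?_⟩
    refine (hout.1.const_mul ((2 * Real.pi / B) ^ ((n : ℝ) / 2))).congr ?_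
    refine (ae_restrict_iff' measurableSet_Ioi).2 (.of_forall fun t ht => ?_)
    simp only [hKn _ t ht]
    exact (hinner t ht).2.symm
  have hG : 0 < Real.Gamma (n : ℝ) := Real.Gamma_pos_of_pos hn0
  have hleft : ∀ η, ∫ t in Ioi (0 : ℝ), K (η, t) = X η ^ (-(n : ℝ)) * Real.Gamma n := fun η =>
    (integral_rpow_mul_exp hn0 (hXpos η)).2
  have hI1 := hKi.integral_prod_left
  simp only [hleft] at hI1
  refine ⟨hXpos, ?_, ?_⟩
  · refine (hI1.mul_const (Real.Gamma n)⁻¹).congr (.of_forall fun η => ?_)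
    simp only
    field_simp
    rfl
  · have hsw := integral_integral_swap (f := fun η t => K (η, t)) hKi
    simp only [hleft] at hsw
    rw [integral_mul_const, setIntegral_congr_fun measurableSet_Ioi (fun t ht => (hinner t ht).2),
      integral_const_mul, hout.2] at hsw
    rw [eq_div_of_mul_eq hG.ne' hsw]
    -- The non-invariant quantity `B = P⁰ + P^d` cancels, leaving a function of `P·P` alone.
    have e5 : (2 * Real.pi / B) ^ ((n : ℝ) / 2) * (mdot P P / 2 / B) ^ (-((n : ℝ) / 2)) =
        (2 * Real.pi) ^ ((n : ℝ) / 2) * (mdot P P / 2) ^ (-((n : ℝ) / 2)) := by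
      rw [Real.div_rpow (by positivity) hB.le, Real.div_rpow (by positivity) hB.le,
        Real.rpow_neg hB.le]
      field_simp
    calc _ = (2 * Real.pi / B) ^ ((n : ℝ) / 2) * (mdot P P / 2 / B) ^ (-((n : ℝ) / 2)) *
          (Real.Gamma ((n : ℝ) / 2) / Real.Gamma n) := by ring
      _ = _ := by rw [e5]; ring

/-! ### Feynman parameters and the value of the integral. -/

theorem norm_ofReal_cpow {p : ℝ} (hp : 0 < p) (z : ℂ) : ‖(p : ℂ) ^ z‖ = p ^ z.re :=
  Complex.norm_cpow_eq_rpow_re_of_pos hp z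

theorem ae_pos_prod :
    ∀ᵐ z : ℝ × ℝ ∂(volume.restrict (Ioi 0)).prod (volume.restrict (Ioi 0)), 0 < z.1 ∧ 0 < z.2 := by
  rw [Measure.prod_restrict]
  exact (ae_restrict_iff' (measurableSet_Ioi.prod measurableSet_Ioi)).2
    (.of_forall fun z hz => hz)

/-- Feynman's parametrization of a product of three powers. -/
theorem feynman_three {X₁ X₂ X₃ : ℝ} (h₁ : 0 < X₁) (h₂ : 0 < X₂) (h₃ : 0 < X₃) {b₁ b₂ b₃ : ℂ}
    (hb₁ : 0 < b₁.re) (hb₂ : 0 < b₂.re) (hb₃ : 0 < b₃.re) :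
    ∫ s in Ioi (0 : ℝ), ∫ t in Ioi (0 : ℝ), (s : ℂ) ^ (b₂ - 1) * ((t : ℂ) ^ (b₃ - 1) *
        ((X₁ + s * X₂ + t * X₃ : ℝ) : ℂ) ^ (-(b₁ + b₂ + b₃))) =
      (X₁ : ℂ) ^ (-b₁) * (X₂ : ℂ) ^ (-b₂) * (X₃ : ℂ) ^ (-b₃) *
        (Complex.Gamma b₁ * Complex.Gamma b₂ * Complex.Gamma b₃ / Complex.Gamma (b₁ + b₂ + b₃)) := by
  -- The `t`-integral is a beta integral with constant term `X₁ + sX₂`; it leaves one of the same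
  -- kind in `s`, and `Γ(b₁ + b₂)` cancels between the two.
  have hin : ∀ s ∈ Ioi (0 : ℝ), ∫ t in Ioi (0 : ℝ), (s : ℂ) ^ (b₂ - 1) * ((t : ℂ) ^ (b₃ - 1) *
        ((X₁ + s * X₂ + t * X₃ : ℝ) : ℂ) ^ (-(b₁ + b₂ + b₃))) =
      (X₃ : ℂ) ^ (-b₃) * (Complex.Gamma b₃ * Complex.Gamma (b₁ + b₂) /
        Complex.Gamma (b₁ + b₂ + b₃)) *
        ((s : ℂ) ^ (b₂ - 1) * ((X₁ + s * X₂ : ℝ) : ℂ) ^ (-(b₁ + b₂))) := by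
    intro s (hs : 0 < s)
    rw [integral_const_mul, (integral_beta_Ioi h₃ (Y := X₁ + s * X₂) (by positivity) hb₃
      (ν := b₁ + b₂ + b₃) (by simp; linarith)).2]
    rw [show b₃ - (b₁ + b₂ + b₃) = -(b₁ + b₂) by ring,
      show b₁ + b₂ + b₃ - b₃ = b₁ + b₂ by ring]
    ring
  rw [setIntegral_congr_fun measurableSet_Ioi hin, integral_const_mul,
    (integral_beta_Ioi h₂ h₁ hb₂ (ν := b₁ + b₂) (by simp; linarith)).2]
  rw [show b₂ - (b₁ + b₂) = -b₁ by ring, show b₁ + b₂ - b₂ = b₁ by ring]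
  have : Complex.Gamma (b₁ + b₂) ≠ 0 :=
    Complex.Gamma_ne_zero_of_re_pos (by simp; linarith)
  field_simp

/-- The kernel left over once the integration over the cone has been carried out. -/
noncomputable def starKernel (a₁ a₂ a₃ : ℂ) (c₁₂ c₂₃ c₃₁ : ℝ) (z : ℝ × ℝ) : ℂ :=
  (z.1 : ℂ) ^ (-(a₃ + a₁) - 1) * ((z.2 : ℂ) ^ (-(a₁ + a₂) - 1) *
    ((c₁₂ * z.1 + z.2 * (c₃₁ + z.1 * c₂₃) : ℝ) : ℂ) ^ (a₁ + a₂ + a₃))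

theorem measurable_starKernel (a₁ a₂ a₃ : ℂ) (c₁₂ c₂₃ c₃₁ : ℝ) :
    Measurable (starKernel a₁ a₂ a₃ c₁₂ c₂₃ c₃₁) := by
  unfold starKernel
  have h : ∀ (g : ℝ × ℝ → ℝ) (b : ℂ), Measurable g → Measurable fun z => (g z : ℂ) ^ b :=
    fun g b hg => (Complex.measurable_ofReal.comp hg).pow_const b
  exact (h _ _ measurable_fst).mul ((h _ _ measurable_snd).mul (h _ _ (by fun_prop)))

/-- Two successive beta integrals. The one in `t` has `Y = c₁₂ s` and produces `(c₁₂ s)^{a₃}`, which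
shifts the exponent of `s` to `-a₁ - 1` and so prepares the one in `s`. -/
theorem integral_starKernel {a₁ a₂ a₃ : ℂ} (ha₁ : a₁.re < 0) (ha₂ : a₂.re < 0) (ha₃ : a₃.re < 0)
    {c₁₂ c₂₃ c₃₁ : ℝ} (h₁₂ : 0 < c₁₂) (h₂₃ : 0 < c₂₃) (h₃₁ : 0 < c₃₁) :
    Integrable (starKernel a₁ a₂ a₃ c₁₂ c₂₃ c₃₁)
      ((volume.restrict (Ioi 0)).prod (volume.restrict (Ioi 0))) ∧
    ∫ z, starKernel a₁ a₂ a₃ c₁₂ c₂₃ c₃₁ z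
      ∂((volume.restrict (Ioi 0)).prod (volume.restrict (Ioi 0))) =
      (c₁₂ : ℂ) ^ a₃ * (c₂₃ : ℂ) ^ a₁ * (c₃₁ : ℂ) ^ a₂ *
        (Complex.Gamma (-a₁) * Complex.Gamma (-a₂) * Complex.Gamma (-a₃) /
          Complex.Gamma (-(a₁ + a₂ + a₃))) := by
  have hout := integral_beta_Ioi h₂₃ h₃₁ (β := -a₁) (ν := -(a₁ + a₂)) (by simpa)
    (by simp; linarith)
  have hin : ∀ s ∈ Ioi (0 : ℝ), _ := fun s (hs : 0 < s) =>
    integral_beta_Ioi (X := c₃₁ + s * c₂₃) (Y := c₁₂ * s) (by positivity) (by positivity)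
      (β := -(a₁ + a₂)) (ν := -(a₁ + a₂ + a₃)) (by simp; linarith) (by simp; linarith)
  have hint : Integrable (starKernel a₁ a₂ a₃ c₁₂ c₂₃ c₃₁)
      ((volume.restrict (Ioi 0)).prod (volume.restrict (Ioi 0))) := by
    rw [integrable_prod_iff (measurable_starKernel ..).aestronglyMeasurable]
    constructor
    · refine (ae_restrict_iff' measurableSet_Ioi).2 (.of_forall fun s hs => ?_)
      have := (hin s hs).1
      rw [neg_neg] at this
      exact Integrable.const_mul this ((s : ℂ) ^ (-(a₃ + a₁) - 1))
    -- The norm of the kernel is the same kernel with the exponents replaced by their real parts, so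
    -- its `t`-integral is a constant times the norm of the integrand in `hout`.
    · refine (hout.1.norm.const_mul (c₁₂ ^ (a₃.re) *
        (Real.Gamma (-(a₁ + a₂).re) * Real.Gamma (-a₃.re) /
          Real.Gamma (-(a₁ + a₂ + a₃).re)))).congr ?_
      refine (ae_restrict_iff' measurableSet_Ioi).2 (.of_forall fun s (hs : 0 < s) => ?_)
      simp only [starKernel, norm_mul]
      rw [integral_const_mul]
      have e1 : ∀ t ∈ Ioi (0 : ℝ), ‖(t : ℂ) ^ (-(a₁ + a₂) - 1)‖ *
          ‖((c₁₂ * s + t * (c₃₁ + s * c₂₃) : ℝ) : ℂ) ^ (a₁ + a₂ + a₃)‖ =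
          t ^ (-(a₁ + a₂).re - 1) * (c₁₂ * s + t * (c₃₁ + s * c₂₃)) ^
            (-(-(a₁ + a₂ + a₃).re)) := by
        intro t (ht : 0 < t)
        rw [norm_ofReal_cpow ht, norm_ofReal_cpow (by positivity)]
        simp
      rw [setIntegral_congr_fun measurableSet_Ioi e1,
        integral_beta_Ioi_real (by positivity) (by positivity) (by simp; linarith)
          (by simp; linarith), norm_ofReal_cpow hs, norm_ofReal_cpow hs,
        norm_ofReal_cpow (by positivity), Real.mul_rpow h₁₂.le hs.le]
      have e2 : -(a₁ + a₂).re - -(a₁ + a₂ + a₃).re = a₃.re := by simp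
      have e3 : -(a₁ + a₂ + a₃).re - -(a₁ + a₂).re = -a₃.re := by simp
      have e4 : s ^ (-a₁ - 1).re = s ^ (-(a₃ + a₁) - 1).re * s ^ a₃.re := by
        rw [← Real.rpow_add hs]
        congr 1
        simp
        ring
      have e5 : (- -(a₁ + a₂)).re = - -(a₁ + a₂).re := by simp
      rw [e2, e3, e4, e5]
      ring
  refine ⟨hint, ?_⟩
  rw [integral_prod _ hint]
  have hin2 : ∀ s ∈ Ioi (0 : ℝ), ∫ t in Ioi (0 : ℝ), starKernel a₁ a₂ a₃ c₁₂ c₂₃ c₃₁ (s, t) =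
      (c₁₂ : ℂ) ^ a₃ * (Complex.Gamma (-(a₁ + a₂)) * Complex.Gamma (-a₃) /
          Complex.Gamma (-(a₁ + a₂ + a₃))) *
        ((s : ℂ) ^ (-a₁ - 1) * ((c₃₁ + s * c₂₃ : ℝ) : ℂ) ^ (- -(a₁ + a₂))) := by
    intro s hs
    have h := (hin s hs).2
    have hs' : 0 < s := hs
    rw [neg_neg] at h
    simp only [starKernel]
    rw [integral_const_mul, h, show -(a₁ + a₂) - -(a₁ + a₂ + a₃) = a₃ by ring,
      show -(a₁ + a₂ + a₃) - -(a₁ + a₂) = -a₃ by ring, Complex.ofReal_mul,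
      Complex.mul_cpow_ofReal_nonneg h₁₂.le hs'.le]
    have e4 : (s : ℂ) ^ (-a₁ - 1) = (s : ℂ) ^ (-(a₃ + a₁) - 1) * (s : ℂ) ^ a₃ := by
      rw [← Complex.cpow_add _ _ (by exact_mod_cast hs'.ne')]
      congr 1
      ring
    rw [e4]
    ring
  rw [setIntegral_congr_fun measurableSet_Ioi hin2, integral_const_mul, hout.2,
    show -a₁ - -(a₁ + a₂) = a₂ by ring, show -(a₁ + a₂) - -a₁ = -a₂ by ring, neg_neg]
  have : Complex.Gamma (-(a₁ + a₂)) ≠ 0 :=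
    Complex.Gamma_ne_zero_of_re_pos (by simp; linarith)
  field_simp

/-- Almost every point of the parabolic basis lies off the generatrix of `ξ`. -/
theorem ae_mdot_parabolicPoint_pos {n : ℕ} (hn : 1 ≤ n) {ξ : Fin (n + 1 + 1) → ℝ}
    (hξ : ξ ∈ futureCone (n + 1)) : ∀ᵐ η : Fin n → ℝ, 0 < mdot (parabolicPoint η) ξ := by
  have : Nonempty (Fin n) := ⟨⟨0, hn⟩⟩
  have h0 := hξ.1
  rw [mdot_self_eq] at h0
  set B := ξ 0 + ξ (Fin.last n).succ with hB
  rcases eq_or_ne B 0 with h | h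
  -- Here `ξ^d = -ξ⁰`: `ξ` spans the one generatrix that the parabolic basis misses, and the product
  -- is the constant `ξ⁰`.
  · refine .of_forall fun η => ?_
    have h1 : ∑ i : Fin n, ξ i.castSucc.succ ^ 2 = 0 := by rw [h] at h0; linarith
    have h2 := (Finset.sum_eq_zero_iff_of_nonneg fun _ _ => sq_nonneg _).1 h1
    have h3 : ∑ i : Fin n, ξ i.castSucc.succ * η i = 0 :=
      Finset.sum_eq_zero fun i hi => by rw [pow_eq_zero_iff two_ne_zero |>.1 (h2 i hi), zero_mul]
    rw [mdot_parabolicPoint, h3, ← hB, h]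
    have := hξ.2
    linarith
  -- The excluded `η` is where the parabolic basis meets the generatrix of `ξ`; a point is null
  -- because `n ≥ 1`.
  · have hne : ∀ᵐ η : Fin n → ℝ, η ≠ fun i => ξ i.castSucc.succ / B := by
      have := measure_singleton (μ := (volume : Measure (Fin n → ℝ))) fun i => ξ i.castSucc.succ / B
      exact compl_mem_ae_iff.2 this
    filter_upwards [hne] with η hη
    refine (mdot_nonneg (parabolicPoint_mem η) hξ).lt_of_ne' fun h2 => hη ?_
    rw [mdot_parabolicPoint, ← hB] at h2
    have h3 : ∑ i, (B * η i - ξ i.castSucc.succ) ^ 2 = 0 := by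
      have : ∑ i, (B * η i - ξ i.castSucc.succ) ^ 2 = B ^ 2 * ∑ i, η i ^ 2 -
          2 * B * ∑ i, ξ i.castSucc.succ * η i + ∑ i : Fin n, ξ i.castSucc.succ ^ 2 := by
        simp only [Finset.mul_sum, ← Finset.sum_sub_distrib, ← Finset.sum_add_distrib]
        exact Finset.sum_congr rfl fun i _ => by ring
      rw [this]
      linear_combination 2 * B * h2 - h0
    have h4 := (Finset.sum_eq_zero_iff_of_nonneg fun _ _ => sq_nonneg _).1 h3
    funext i
    have := pow_eq_zero_iff two_ne_zero |>.1 (h4 i (Finset.mem_univ i))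
    field_simp
    linarith

theorem abs_last_le {n : ℕ} {ξ : Fin (n + 1 + 1) → ℝ} (hξ : ξ ∈ futureCone (n + 1)) :
    0 ≤ ξ 0 + ξ (Fin.last n).succ ∧ 0 ≤ ξ 0 - ξ (Fin.last n).succ := by
  have h0 := hξ.1
  have h2 := hξ.2
  rw [mdot_self_eq] at h0
  have : 0 ≤ ∑ i : Fin n, ξ i.castSucc.succ ^ 2 := Finset.sum_nonneg fun _ _ => sq_nonneg _
  constructor <;> nlinarith

/-- The star-triangle relation on the parabolic basis. -/
theorem integral_starIntegrand_parabolicPoint {n : ℕ} (hn : 1 ≤ n) {a₁ a₂ a₃ : ℂ}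
    (hsum : 2 * (a₁ + a₂ + a₃) = 1 - ((n + 1 : ℕ) : ℂ))
    (ha₁ : a₁.re < 0) (ha₂ : a₂.re < 0) (ha₃ : a₃.re < 0)
    {ξ₁ ξ₂ ξ₃ : Fin (n + 1 + 1) → ℝ}
    (hξ₁ : ξ₁ ∈ futureCone (n + 1)) (hξ₂ : ξ₂ ∈ futureCone (n + 1))
    (hξ₃ : ξ₃ ∈ futureCone (n + 1))
    (h₁₂ : mdot ξ₁ ξ₂ ≠ 0) (h₂₃ : mdot ξ₂ ξ₃ ≠ 0) (h₃₁ : mdot ξ₃ ξ₁ ≠ 0) :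
    Integrable (fun η : Fin n → ℝ => starIntegrand a₁ a₂ a₃ ξ₁ ξ₂ ξ₃ (parabolicPoint η)) ∧
    ∫ η : Fin n → ℝ, starIntegrand a₁ a₂ a₃ ξ₁ ξ₂ ξ₃ (parabolicPoint η) =
      starConst (n + 1) a₁ a₂ a₃ *
        ((mdot ξ₁ ξ₂ : ℂ) ^ a₃ * (mdot ξ₂ ξ₃ : ℂ) ^ a₁ * (mdot ξ₃ ξ₁ : ℂ) ^ a₂) := by
  have hs : a₁ + a₂ + a₃ = -((n / 2 : ℝ) : ℂ) := by
    push_cast at hsum ⊢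
    linear_combination hsum / 2
  have hc₁₂ := (mdot_nonneg hξ₁ hξ₂).lt_of_ne' h₁₂
  have hc₂₃ := (mdot_nonneg hξ₂ hξ₃).lt_of_ne' h₂₃
  have hc₃₁ := (mdot_nonneg hξ₃ hξ₁).lt_of_ne' h₃₁
  have hn0 : (0 : ℝ) < n := by exact_mod_cast hn
  set μ : Measure (ℝ × ℝ) := (volume.restrict (Ioi 0)).prod (volume.restrict (Ioi 0)) with hμ
  set P : ℝ × ℝ → Fin (n + 1 + 1) → ℝ := fun z => ξ₁ + z.1 • ξ₂ + z.2 • ξ₃ with hPdef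
  set C : ℝ := (2 * Real.pi) ^ ((n : ℝ) / 2) * Real.Gamma ((n : ℝ) / 2) / Real.Gamma n with hC
  -- The Feynman integrand. Its power is `-n` because the three exponents of `F` add up to `-n`,
  -- which is the exponent at which the integral over `η` is Lorentz invariant.
  set G : (Fin n → ℝ) × (ℝ × ℝ) → ℂ := fun w => (w.2.1 : ℂ) ^ (-(a₃ + a₁) - 1) *
    ((w.2.2 : ℂ) ^ (-(a₁ + a₂) - 1) * (mdot (parabolicPoint w.1) (P w.2) : ℂ) ^ (-(n : ℂ))) with hG
  have hPmul : ∀ ξ z, mdot ξ (P z) = mdot ξ ξ₁ + z.1 * mdot ξ ξ₂ + z.2 * mdot ξ ξ₃ := by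
    intro ξ z
    simp only [hPdef, mdot_add_right, mdot_smul_right]
  have hPP : ∀ z, mdot (P z) (P z) / 2 =
      mdot ξ₁ ξ₂ * z.1 + z.2 * (mdot ξ₃ ξ₁ + z.1 * mdot ξ₂ ξ₃) := by
    intro z
    rw [hPmul, mdot_comm (P z) ξ₁, mdot_comm (P z) ξ₂, mdot_comm (P z) ξ₃, hPmul, hPmul, hPmul,
      hξ₁.1, hξ₂.1, hξ₃.1, mdot_comm ξ₂ ξ₁, mdot_comm ξ₁ ξ₃, mdot_comm ξ₃ ξ₂]
    ring
  have hquad : ∀ z : ℝ × ℝ, 0 < z.1 → 0 < z.2 →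
      (∀ η : Fin n → ℝ, 0 < mdot (parabolicPoint η) (P z)) ∧
      Integrable (fun η : Fin n → ℝ => mdot (parabolicPoint η) (P z) ^ (-(n : ℝ))) ∧
      ∫ η : Fin n → ℝ, mdot (parabolicPoint η) (P z) ^ (-(n : ℝ)) =
        C * (mdot (P z) (P z) / 2) ^ (-((n : ℝ) / 2)) := by
    intro z hz1 hz2
    have hpos : 0 < mdot (P z) (P z) := by
      have : 0 < mdot (P z) (P z) / 2 := by rw [hPP]; positivity
      linarith
    refine integral_mdot_parabolicPoint_rpow hn ?_ hpos
    obtain ⟨p1, q1⟩ := abs_last_le hξ₁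
    obtain ⟨p2, q2⟩ := abs_last_le hξ₂
    obtain ⟨p3, q3⟩ := abs_last_le hξ₃
    -- `P·P > 0` makes `(P⁰ + P^d)(P⁰ - P^d)` positive, so nonnegativity of one factor gives
    -- positivity of the other.
    have hA : 0 ≤ P z 0 - P z (Fin.last n).succ := by
      have : P z 0 - P z (Fin.last n).succ = (ξ₁ 0 - ξ₁ (Fin.last n).succ) +
        z.1 * (ξ₂ 0 - ξ₂ (Fin.last n).succ) + z.2 * (ξ₃ 0 - ξ₃ (Fin.last n).succ) := by
        simp [hPdef]; ring
      rw [this]; positivity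
    have hsq : 0 ≤ ∑ i : Fin n, P z i.castSucc.succ ^ 2 := Finset.sum_nonneg fun _ _ => sq_nonneg _
    rw [mdot_self_eq] at hpos
    exact pos_of_mul_pos_left (by linarith) hA
  have hGm : Measurable G := by
    have h : ∀ (g : (Fin n → ℝ) × (ℝ × ℝ) → ℝ) (b : ℂ), Measurable g →
        Measurable fun z => (g z : ℂ) ^ b :=
      fun g b hg => (Complex.measurable_ofReal.comp hg).pow_const b
    simp only [hG]
    refine (h _ _ (by fun_prop)).mul ((h _ _ (by fun_prop)).mul (h _ _ ?_))
    simp only [mdot_parabolicPoint, hPdef, Pi.add_apply, Pi.smul_apply, smul_eq_mul]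
    fun_prop
  have hGz : ∀ z : ℝ × ℝ, 0 < z.1 → 0 < z.2 → ∀ η, G (η, z) = ((z.1 : ℂ) ^ (-(a₃ + a₁) - 1) *
      (z.2 : ℂ) ^ (-(a₁ + a₂) - 1)) * ((mdot (parabolicPoint η) (P z) ^ (-(n : ℝ)) : ℝ) : ℂ) := by
    intro z h1 h2 η
    simp only [hG]
    rw [Complex.ofReal_cpow ((hquad z h1 h2).1 η).le, mul_assoc]
    push_cast
    rfl
  have hker := integral_starKernel ha₁ ha₂ ha₃ hc₁₂ hc₂₃ hc₃₁
  have hHz : ∀ z : ℝ × ℝ, 0 < z.1 → 0 < z.2 →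
      starKernel a₁ a₂ a₃ (mdot ξ₁ ξ₂) (mdot ξ₂ ξ₃) (mdot ξ₃ ξ₁) z =
      ((z.1 : ℂ) ^ (-(a₃ + a₁) - 1) * (z.2 : ℂ) ^ (-(a₁ + a₂) - 1)) *
        (((mdot (P z) (P z) / 2) ^ (-((n : ℝ) / 2)) : ℝ) : ℂ) := by
    intro z h1 h2
    have : 0 < mdot (P z) (P z) / 2 := by rw [hPP]; positivity
    rw [Complex.ofReal_cpow this.le, hPP, starKernel, hs, mul_assoc]
    push_cast
    rfl
  -- Integrating the norm over `η` first gives `C` times the norm of the star kernel, already known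
  -- to be integrable.
  have hGi : Integrable G (volume.prod μ) := by
    rw [integrable_prod_iff' hGm.aestronglyMeasurable]
    constructor
    · filter_upwards [ae_pos_prod] with z hz
      simp only [hGz z hz.1 hz.2]
      exact ((hquad z hz.1 hz.2).2.1.ofReal).const_mul _
    · refine (hker.1.norm.const_mul C).congr ?_
      filter_upwards [ae_pos_prod] with z hz
      have h3 : 0 < mdot (P z) (P z) / 2 := by
        have := hz.1; have := hz.2; rw [hPP]; positivity
      have h4 : ∀ η, ‖((mdot (parabolicPoint η) (P z) ^ (-(n : ℝ)) : ℝ) : ℂ)‖ =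
          mdot (parabolicPoint η) (P z) ^ (-(n : ℝ)) := fun η => by
        rw [Complex.norm_real, Real.norm_of_nonneg (Real.rpow_nonneg ((hquad z hz.1 hz.2).1 η).le _)]
      have h5 : ‖(((mdot (P z) (P z) / 2) ^ (-((n : ℝ) / 2)) : ℝ) : ℂ)‖ =
          (mdot (P z) (P z) / 2) ^ (-((n : ℝ) / 2)) := by
        rw [Complex.norm_real, Real.norm_of_nonneg (Real.rpow_nonneg h3.le _)]
      simp only [hGz z hz.1 hz.2, hHz z hz.1 hz.2, norm_mul, h4, h5]
      rw [integral_const_mul, (hquad z hz.1 hz.2).2.2]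
      ring
  -- The Gamma factor of Feynman's formula, to be divided out at the end. `Γ(n)` then cancels
  -- against `C`, and so does `Γ(n/2) = Γ(-(a₁+a₂+a₃))` against the kernel.
  set γ : ℂ := Complex.Gamma (-a₂ - a₃) * Complex.Gamma (-a₃ - a₁) * Complex.Gamma (-a₁ - a₂) /
    Complex.Gamma n with hγ
  have hγ0 : γ ≠ 0 := by
    refine div_ne_zero (mul_ne_zero (mul_ne_zero ?_ ?_) ?_) ?_ <;>
      refine Complex.Gamma_ne_zero_of_re_pos ?_
    · simp; linarith
    · simp; linarith
    · simp; linarith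
    · simpa using hn0
  have hstar : ∀ᵐ η : Fin n → ℝ, ∫ z, G (η, z) ∂μ =
      γ * starIntegrand a₁ a₂ a₃ ξ₁ ξ₂ ξ₃ (parabolicPoint η) := by
    filter_upwards [hGi.prod_right_ae, ae_mdot_parabolicPoint_pos hn hξ₁,
      ae_mdot_parabolicPoint_pos hn hξ₂, ae_mdot_parabolicPoint_pos hn hξ₃] with η hi p1 p2 p3
    rw [hμ, integral_prod _ hi]
    have hf := feynman_three p1 p2 p3 (b₁ := -(a₂ + a₃)) (b₂ := -(a₃ + a₁)) (b₃ := -(a₁ + a₂))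
      (by simp; linarith) (by simp; linarith) (by simp; linarith)
    have e : -(a₂ + a₃) + -(a₃ + a₁) + -(a₁ + a₂) = (n : ℂ) := by
      push_cast at hsum; linear_combination -hsum
    rw [e, neg_neg, neg_neg, neg_neg] at hf
    simp only [hG, hPmul]
    rw [hf, hγ, starIntegrand]
    rw [show -a₂ - a₃ = -(a₂ + a₃) by ring, show -a₃ - a₁ = -(a₃ + a₁) by ring,
      show -a₁ - a₂ = -(a₁ + a₂) by ring]
    ring
  have hval : ∫ η : Fin n → ℝ, ∫ z, G (η, z) ∂μ = (C : ℂ) *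
      ∫ z, starKernel a₁ a₂ a₃ (mdot ξ₁ ξ₂) (mdot ξ₂ ξ₃) (mdot ξ₃ ξ₁) z ∂μ := by
    rw [integral_integral_swap (f := fun η z => G (η, z)) hGi, ← integral_const_mul]
    refine integral_congr_ae ?_
    filter_upwards [ae_pos_prod] with z hz
    simp only [hGz z hz.1 hz.2, hHz z hz.1 hz.2]
    rw [integral_const_mul, integral_complex_ofReal, (hquad z hz.1 hz.2).2.2]
    push_cast
    ring
  constructor
  · refine ((hGi.integral_prod_left.congr hstar).const_mul γ⁻¹).congr (.of_forall fun η => ?_)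
    simp only
    rw [inv_mul_cancel_left₀ hγ0]
  · rw [integral_congr_ae hstar, integral_const_mul, hker.2, hs, neg_neg] at hval
    rw [← mul_right_inj' hγ0, hval, starConst, hγ, hC]
    have g0 : Complex.Gamma ((n / 2 : ℝ) : ℂ) ≠ 0 :=
      Complex.Gamma_ne_zero_of_re_pos (by simpa using hn0)
    have g1 : Complex.Gamma (-a₂ - a₃) ≠ 0 :=
      Complex.Gamma_ne_zero_of_re_pos (by simp; linarith)
    have g2 : Complex.Gamma (-a₃ - a₁) ≠ 0 :=
      Complex.Gamma_ne_zero_of_re_pos (by simp; linarith)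
    have g3 : Complex.Gamma (-a₁ - a₂) ≠ 0 :=
      Complex.Gamma_ne_zero_of_re_pos (by simp; linarith)
    have e1 : (((2 * Real.pi) ^ ((n : ℝ) / 2) : ℝ) : ℂ) =
        (2 * Real.pi : ℂ) ^ ((((n + 1 : ℕ) : ℂ) - 1) / 2) := by
      rw [Complex.ofReal_cpow (by positivity)]
      push_cast
      congr 1
      ring
    rw [← e1]
    push_cast [← Complex.Gamma_ofReal]
    push_cast at g0
    field_simp

/-! ### Polar coordinates attached to a basis of the cone. -/

/-- The spatial part as a continuous linear map. -/
def spatialCLM (d : ℕ) : (Fin (d + 1) → ℝ) →L[ℝ] (Fin d → ℝ) :=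
  ContinuousLinearMap.pi fun i => ContinuousLinearMap.proj i.succ

@[simp] theorem spatialCLM_apply {d : ℕ} (ξ : Fin (d + 1) → ℝ) : spatialCLM d ξ = spatial ξ := rfl

theorem det_rows_mul {n : ℕ} (x : Fin (n + 1) → ℝ) (r : Fin n → ℝ) (v : Fin n → Fin (n + 1) → ℝ) :
    (rows x fun i => r i • v i).det = (∏ i, r i) * (rows x v).det := by
  have h := Matrix.det_mul_column (Fin.cons 1 r) (rows x v)
  rw [Fin.prod_univ_succ] at h
  simp only [Fin.cons_zero, Fin.cons_succ, one_mul] at h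
  rw [← h]
  congr 1
  ext i j
  refine Fin.cases ?_ (fun i => ?_) i
  · simp [rows]
  · simp [rows]

theorem det_rows_smul {n : ℕ} (x : Fin (n + 1) → ℝ) (r : ℝ) (v : Fin n → Fin (n + 1) → ℝ) :
    (rows x fun i => r • v i).det = r ^ n * (rows x v).det := by
  simpa using det_rows_mul x (fun _ => r) v

/-- The polar coordinates `(r, u) ↦ r φ(u)` (spatial part) attached to a basis of the cone. -/
def conePolar {n : ℕ} (φ : (Fin n → ℝ) → Fin (n + 1 + 1) → ℝ) (w : Fin (n + 1) → ℝ) :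
    Fin (n + 1) → ℝ := w 0 • spatial (φ (spatialCLM n w))

/-- The domain of `conePolar`. -/
def conePolarDomain {n : ℕ} (U : Set (Fin n → ℝ)) : Set (Fin (n + 1) → ℝ) :=
  {w | 0 < w 0 ∧ spatialCLM n w ∈ U}

theorem isOpen_conePolarDomain {n : ℕ} {U : Set (Fin n → ℝ)} (hU : IsOpen U) :
    IsOpen (conePolarDomain U) :=
  (isOpen_lt continuous_const (continuous_apply 0)).inter (hU.preimage (spatialCLM n).continuous)

/-- The derivative of `conePolar`. -/
noncomputable def conePolarDeriv {n : ℕ} (U : Set (Fin n → ℝ))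
    (φ : (Fin n → ℝ) → Fin (n + 1 + 1) → ℝ) (w : Fin (n + 1) → ℝ) :
    (Fin (n + 1) → ℝ) →L[ℝ] (Fin (n + 1) → ℝ) :=
  w 0 • (spatialCLM (n + 1) ∘L fderivWithin ℝ φ U (spatialCLM n w) ∘L spatialCLM n) +
    (ContinuousLinearMap.proj (R := ℝ) (φ := fun _ : Fin (n + 1) => ℝ) 0).smulRight
      (spatial (φ (spatialCLM n w)))

theorem hasFDerivWithinAt_conePolar {n : ℕ} {U : Set (Fin n → ℝ)}
    {φ : (Fin n → ℝ) → Fin (n + 1 + 1) → ℝ} (hφ : DifferentiableOn ℝ φ U) {w : Fin (n + 1) → ℝ}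
    (hw : w ∈ conePolarDomain U) :
    HasFDerivWithinAt (conePolar φ) (conePolarDeriv U φ w) (conePolarDomain U) w := by
  have h1 := (hφ _ hw.2).hasFDerivWithinAt.comp w (spatialCLM n).hasFDerivWithinAt
    (fun x hx => hx.2 : MapsTo (spatialCLM n) (conePolarDomain U) U)
  have h2 := ((spatialCLM (n + 1)).hasFDerivAt.comp_hasFDerivWithinAt w h1)
  have h3 := (ContinuousLinearMap.proj (R := ℝ) (φ := fun _ : Fin (n + 1) => ℝ) 0).hasFDerivWithinAt
    (s := conePolarDomain U) (x := w)
  exact h3.smul h2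

/-- The columns of the derivative are the spatial parts of `φ` (radial direction) and of `r ∂ₖφ`;
extracting `r^n` leaves the determinant that defines `α`. -/
theorem det_conePolarDeriv {n : ℕ} {U : Set (Fin n → ℝ)} {φ : (Fin n → ℝ) → Fin (n + 1 + 1) → ℝ}
    {w : Fin (n + 1) → ℝ} (hφ : φ (spatialCLM n w) 0 ≠ 0) :
    (conePolarDeriv U φ w).det =
      w 0 ^ n * (φ (spatialCLM n w) 0 * pullbackDensity φ U (spatialCLM n w)) := by
  rw [pullbackDensity, coneForm_eq_det, mul_inv_cancel_left₀ hφ, ← det_rows_smul,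
    ContinuousLinearMap.det, ← LinearMap.det_toMatrix', ← Matrix.det_transpose]
  congr 1
  ext i j
  rw [Matrix.transpose_apply, LinearMap.toMatrix'_apply]
  refine Fin.cases ?_ (fun i => ?_) i
  · have : spatial (Pi.single (0 : Fin (n + 1)) (1 : ℝ)) = 0 := by
      funext k; simp [spatial]
    simp only [conePolarDeriv, rows]
    simp [this, show spatial (0 : Fin (n + 1 + 1) → ℝ) = 0 from rfl]
  · have : spatial (Pi.single i.succ (1 : ℝ)) = Pi.single i (1 : ℝ) := by
      funext k; simp [spatial, Pi.single_apply]
    simp [conePolarDeriv, rows, this, spatial]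

theorem injOn_conePolar {n : ℕ} {U : Set (Fin n → ℝ)} {φ : (Fin n → ℝ) → Fin (n + 1 + 1) → ℝ}
    (h : IsConeBase U φ) : InjOn (conePolar φ) (conePolarDomain U) := by
  intro w hw v hv hwv
  have h1 : w 0 • φ (spatialCLM n w) = v 0 • φ (spatialCLM n v) := by
    rw [← coneLift_spatial (h.mem_cone _ hw.2), ← coneLift_spatial (h.mem_cone _ hv.2),
      ← coneLift_smul hw.1.le, ← coneLift_smul hv.1.le]
    exact congrArg coneLift hwv
  have h2 : spatialCLM n w = spatialCLM n v := by
    refine h.inj _ hw.2 _ hv.2 ((w 0)⁻¹ * v 0) (mul_pos (inv_pos.2 hw.1) hv.1) ?_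
    rw [mul_smul, ← h1, smul_smul, inv_mul_cancel₀ hw.1.ne', one_smul]
  have h3 : w 0 = v 0 := by
    rw [h2] at h1
    have := congrFun h1 0
    exact mul_right_cancel₀ (h.mem_cone _ hv.2).2.ne' this
  funext i
  refine Fin.cases h3 (fun i => congrFun h2 i) i

theorem image_conePolar_ae_eq_univ {n : ℕ} {U : Set (Fin n → ℝ)}
    {φ : (Fin n → ℝ) → Fin (n + 1 + 1) → ℝ} (h : IsConeBase U φ) :
    conePolar φ '' conePolarDomain U =ᵐ[volume] univ := by
  rw [Filter.eventuallyEq_univ]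
  filter_upwards [h.covers] with x ⟨u, hu, r, hr, hx⟩
  refine ⟨Fin.cons r⁻¹ u, ⟨by simpa using hr, hu⟩, ?_⟩
  have : spatialCLM n (Fin.cons r⁻¹ u) = u := rfl
  funext i
  simp only [conePolar, this, Fin.cons_zero, Pi.smul_apply, smul_eq_mul, spatial, hx]
  field_simp

/-- The radial integral in polar coordinates, with `c = φ⁰(u)`. Its value does not depend on `c`,
which makes the integral independent of the basis. -/
theorem integral_exp_neg_mul {c : ℝ} (hc : 0 < c) :
    IntegrableOn (fun r : ℝ => c * Real.exp (-(r * c))) (Ioi 0) ∧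
    ∫ r in Ioi (0 : ℝ), c * Real.exp (-(r * c)) = 1 := by
  have h := integral_rpow_mul_exp one_pos hc
  simp only [sub_self, Real.rpow_zero, one_mul, Real.Gamma_one, mul_one] at h
  have e : ∀ r : ℝ, Real.exp (-(r * c)) = Real.exp (-(c * r)) := fun r => by rw [mul_comm]
  simp only [e]
  refine ⟨h.1.const_mul c, ?_⟩
  rw [integral_const_mul, h.2, Real.rpow_neg_one, mul_inv_cancel₀ hc.ne']

theorem aestronglyMeasurable_pullback {n : ℕ} {U : Set (Fin n → ℝ)}
    {φ : (Fin n → ℝ) → Fin (n + 1 + 1) → ℝ} (h : IsConeBase U φ)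
    {F : (Fin (n + 1 + 1) → ℝ) → ℂ} (hFm : Measurable F) :
    AEMeasurable φ (volume.restrict U) ∧
    AEStronglyMeasurable (fun u => F (φ u) * ((|pullbackDensity φ U u| : ℝ) : ℂ))
      (volume.restrict U) := by
  have hU := h.isOpen.measurableSet
  have hφ : AEMeasurable φ (volume.restrict U) := h.contDiffOn.continuousOn.aemeasurable hU
  refine ⟨hφ, ?_⟩
  have hd : ContinuousOn (pullbackDensity φ U) U := by
    have h1 := h.contDiffOn.continuousOn_fderivWithin h.isOpen.uniqueDiffOn le_rfl
    have h2 : ContinuousOn (fun u => (φ u 0)⁻¹) U :=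
      ContinuousOn.inv₀ ((continuous_apply 0).comp_continuousOn h.contDiffOn.continuousOn)
        fun u hu => (h.mem_cone u hu).2.ne'
    refine ContinuousOn.congr (f := fun u => (φ u 0)⁻¹ * (rows (spatial (φ u)) fun i =>
      spatial (fderivWithin ℝ φ U u (Pi.single i 1))).det) ?_ fun u _ => coneForm_eq_det _ _
    refine h2.mul ?_
    refine Continuous.comp_continuousOn (g := Matrix.det) (continuous_id.matrix_det) ?_
    refine continuousOn_pi.2 fun i => ?_
    refine Fin.cases ?_ (fun i => ?_) i
    · exact (spatialCLM (n + 1)).continuous.comp_continuousOn h.contDiffOn.continuousOn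
    · exact (spatialCLM (n + 1)).continuous.comp_continuousOn (h1.clm_apply continuousOn_const)
  refine ((hFm.comp_aemeasurable hφ).mul ?_).aestronglyMeasurable
  exact Complex.measurable_ofReal.comp_aemeasurable (hd.abs.aemeasurable hU)

/-- The integral over a basis of the cone as an integral over the whole cone. -/
theorem IsConeBase.integral_eq {n : ℕ} {U : Set (Fin n → ℝ)}
    {φ : (Fin n → ℝ) → Fin (n + 1 + 1) → ℝ} (h : IsConeBase U φ)
    {F : (Fin (n + 1 + 1) → ℝ) → ℂ} (hFm : Measurable F)
    (hF : ∀ ξ ∈ futureCone (n + 1), ∀ r : ℝ, 0 < r → F (r • ξ) = ((r ^ n)⁻¹ : ℝ) * F ξ) :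
    (IntegrableOn (fun u => F (φ u) * ((|pullbackDensity φ U u| : ℝ) : ℂ)) U ↔
      Integrable fun x => F (coneLift x) * ((Real.exp (-(coneLift x 0)) : ℝ) : ℂ)) ∧
    ∫ u in U, F (φ u) * ((|pullbackDensity φ U u| : ℝ) : ℂ) =
      ∫ x, F (coneLift x) * ((Real.exp (-(coneLift x 0)) : ℝ) : ℂ) := by
  set g : (Fin (n + 1) → ℝ) → ℂ := fun x => F (coneLift x) * ((Real.exp (-(coneLift x 0)) : ℝ) : ℂ)
    with hg
  set f : (Fin n → ℝ) → ℂ := fun u => F (φ u) * ((|pullbackDensity φ U u| : ℝ) : ℂ) with hf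
  -- The integrand `g` in polar coordinates: the `r^n` of the Jacobian cancels the `r^{-n}` from
  -- homogeneity, and the factor `φ⁰` of the Jacobian normalises the exponential.
  set K : ℝ × (Fin n → ℝ) → ℂ := fun z => f z.2 *
    ((φ z.2 0 * Real.exp (-(z.1 * φ z.2 0)) : ℝ) : ℂ) with hK
  have hU := h.isOpen.measurableSet
  obtain ⟨hφm, hfm⟩ := aestronglyMeasurable_pullback h hFm
  have hD : ∀ w ∈ conePolarDomain U, HasFDerivWithinAt (conePolar φ) (conePolarDeriv U φ w)
      (conePolarDomain U) w := fun w hw =>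
    hasFDerivWithinAt_conePolar (h.contDiffOn.differentiableOn one_ne_zero) hw
  have hS := (isOpen_conePolarDomain h.isOpen).measurableSet
  set e := MeasurableEquiv.piFinSuccAbove (fun _ : Fin (n + 1) => ℝ) 0 with he
  have hpres : MeasurePreserving e := volume_preserving_piFinSuccAbove (fun _ => ℝ) 0
  have he_apply : ∀ w, e w = (w 0, spatialCLM n w) := fun w => rfl
  have hpre : conePolarDomain U = e ⁻¹' (Ioi 0 ×ˢ U) := rfl
  have hpoint : EqOn (fun w => |(conePolarDeriv U φ w).det| • g (conePolar φ w))
      (fun w => K (e w)) (conePolarDomain U) := by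
    intro w hw
    have hw0 : 0 < w 0 := hw.1
    have hc := h.mem_cone _ hw.2
    have h0 := hc.2
    simp only [hK, hf, hg, he_apply]
    rw [det_conePolarDeriv h0.ne', conePolar, coneLift_smul hw.1.le, coneLift_spatial hc,
      hF _ hc _ hw.1, abs_mul, abs_mul, abs_of_pos (pow_pos hw.1 n), abs_of_pos h0,
      Complex.real_smul]
    have : (w 0 : ℂ) ^ n ≠ 0 := pow_ne_zero _ (by exact_mod_cast hw0.ne')
    simp only [Pi.smul_apply, smul_eq_mul]
    push_cast
    field_simp
  have hprod : (volume : Measure (ℝ × (Fin n → ℝ))).restrict (Ioi 0 ×ˢ U) =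
      (volume.restrict (Ioi 0)).prod (volume.restrict U) := by
    rw [Measure.prod_restrict]
    rfl
  have hKm : AEStronglyMeasurable K ((volume.restrict (Ioi 0)).prod (volume.restrict U)) := by
    have h0 : AEMeasurable (fun z : ℝ × (Fin n → ℝ) => φ z.2 0)
        ((volume.restrict (Ioi 0)).prod (volume.restrict U)) :=
      (measurable_pi_apply 0).comp_aemeasurable hφm.comp_snd
    refine hfm.comp_snd.mul (AEMeasurable.aestronglyMeasurable ?_)
    refine Complex.measurable_ofReal.comp_aemeasurable (h0.mul ?_)
    exact Real.measurable_exp.comp_aemeasurable (measurable_fst.aemeasurable.mul h0).neg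
  have hr : ∀ u ∈ U, IntegrableOn (fun r => K (r, u)) (Ioi 0) ∧ ∫ r in Ioi (0 : ℝ), K (r, u) = f u ∧
      ∫ r in Ioi (0 : ℝ), ‖K (r, u)‖ = ‖f u‖ := by
    intro u hu
    have h0 := (h.mem_cone u hu).2
    obtain ⟨h1, h2⟩ := integral_exp_neg_mul h0
    refine ⟨Integrable.const_mul h1.ofReal (f u), ?_, ?_⟩
    · simp only [hK]
      rw [integral_const_mul, integral_complex_ofReal, h2, Complex.ofReal_one, mul_one]
    · simp only [hK, norm_mul (f u), Complex.norm_real]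
      rw [integral_const_mul]
      have : ∀ r : ℝ, ‖φ u 0 * Real.exp (-(r * φ u 0))‖ = φ u 0 * Real.exp (-(r * φ u 0)) :=
        fun r => Real.norm_of_nonneg (by positivity)
      simp only [this, h2, mul_one]
  have hKint : Integrable K ((volume.restrict (Ioi 0)).prod (volume.restrict U)) ↔
      IntegrableOn f U := by
    have hn : (fun u => ∫ r in Ioi (0 : ℝ), ‖K (r, u)‖) =ᵐ[volume.restrict U] fun u => ‖f u‖ :=
      (ae_restrict_iff' hU).2 (.of_forall fun u hu => (hr u hu).2.2)
    rw [integrable_prod_iff' hKm, integrable_congr hn, integrable_norm_iff hfm]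
    refine ⟨fun h => h.2, fun h => ⟨?_, h⟩⟩
    exact (ae_restrict_iff' hU).2 (.of_forall fun u hu => (hr u hu).1)
  have hmain : Integrable g ↔ IntegrableOn f U := by
    rw [← integrableOn_univ, ← integrableOn_congr_set_ae (image_conePolar_ae_eq_univ h),
      integrableOn_image_iff_integrableOn_abs_det_fderiv_smul _ hS hD (injOn_conePolar h),
      integrableOn_congr_fun hpoint hS, hpre, ← Function.comp_def K,
      hpres.integrableOn_comp_preimage e.measurableEmbedding, IntegrableOn, hprod, hKint]
  refine ⟨hmain.symm, ?_⟩
  rw [← setIntegral_univ (f := g), ← setIntegral_congr_set (image_conePolar_ae_eq_univ h),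
    integral_image_eq_integral_abs_det_fderiv_smul _ hS hD (injOn_conePolar h),
    setIntegral_congr_fun hS hpoint, hpre, hpres.setIntegral_preimage_emb e.measurableEmbedding,
    hprod]
  -- Without integrability both sides are 0 by convention.
  by_cases hi : IntegrableOn f U
  · rw [integral_prod_symm _ (hKint.2 hi)]
    exact (setIntegral_congr_fun hU fun u hu => (hr u hu).2.1).symm
  · rw [integral_undef hi, integral_undef (fun hc => hi (hKint.1 hc))]

theorem det_rows_smul_left {n : ℕ} (c : ℝ) (x : Fin (n + 1) → ℝ) (v : Fin n → Fin (n + 1) → ℝ) :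
    (rows (c • x) v).det = c * (rows x v).det := by
  rw [Matrix.det_succ_row_zero, Matrix.det_succ_row_zero, Finset.mul_sum]
  refine Finset.sum_congr rfl fun j _ => ?_
  have : (rows (c • x) v).submatrix Fin.succ j.succAbove =
      (rows x v).submatrix Fin.succ j.succAbove := rfl
  rw [this]
  simp only [rows, Matrix.of_apply, Fin.cons_zero, Pi.smul_apply, smul_eq_mul]
  ring

/-! ### The parabolic basis -/

theorem contDiff_parabolicPoint {n : ℕ} : ContDiff ℝ 1 (parabolicPoint (n := n)) := by
  rw [contDiff_pi]
  intro j
  refine Fin.cases ?_ (fun j => ?_) j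
  · simp only [parabolicPoint, Fin.cons_zero]
    fun_prop
  · refine Fin.lastCases ?_ (fun j => ?_) j
    · simp only [parabolicPoint, Fin.cons_succ, Fin.snoc_last]
      fun_prop
    · simp only [parabolicPoint, Fin.cons_succ, Fin.snoc_castSucc]
      fun_prop

theorem isConeBase_parabolicPoint {n : ℕ} (hn : 1 ≤ n) :
    IsConeBase univ (parabolicPoint (n := n)) where
  isOpen := isOpen_univ
  contDiffOn := contDiff_parabolicPoint.contDiffOn
  mem_cone u _ := parabolicPoint_mem u
  inj u _ v _ r _ h := by
    have h0 := congrFun h 0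
    have h1 := congrFun h (Fin.last n).succ
    simp only [parabolicPoint, Fin.cons_zero, Fin.cons_succ, Fin.snoc_last, Pi.smul_apply,
      smul_eq_mul] at h0 h1
    -- Both points satisfy `ξ⁰ + ξ^d = 1`; add the two coordinates.
    have hr : r = 1 := by linarith
    funext i
    have h2 := congrFun h i.castSucc.succ
    simpa [parabolicPoint, hr] using h2
  covers := by
    have hne : ∀ᵐ x : Fin (n + 1) → ℝ, x (Fin.castSucc ⟨0, hn⟩) ≠ 0 :=
      compl_mem_ae_iff.2 (Measure.pi_hyperplane _ _ _)
    filter_upwards [hne] with x hx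
    set N := √(∑ j, x j ^ 2) with hN
    have hpos : 0 < ∑ i : Fin n, x i.castSucc ^ 2 :=
      sum_sq_pos fun h => hx (congrFun h ⟨0, hn⟩)
    have hN2 : N ^ 2 = ∑ i : Fin n, x i.castSucc ^ 2 + x (Fin.last n) ^ 2 := by
      rw [hN, Real.sq_sqrt (Finset.sum_nonneg fun _ _ => sq_nonneg _), Fin.sum_univ_castSucc]
    have hT : 0 < N + x (Fin.last n) := by
      have : |x (Fin.last n)| < N := by
        refine abs_lt_of_sq_lt_sq ?_ (Real.sqrt_nonneg _)
        rw [hN2]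
        linarith
      linarith [neg_abs_le (x (Fin.last n))]
    -- Rescaling `(|x|, x)` to `ξ⁰ + ξ^d = 1` requires `|x| + x_d ≠ 0`, guaranteed by the nonzero
    -- first coordinate.
    refine ⟨fun i => (N + x (Fin.last n))⁻¹ * x i.castSucc, mem_univ _, (N + x (Fin.last n))⁻¹,
      inv_pos.2 hT, fun i => ?_⟩
    refine Fin.lastCases ?_ (fun i => ?_) i
    · simp only [parabolicPoint, Fin.cons_succ, Fin.snoc_last, mul_pow, ← Finset.mul_sum]
      have : ∑ i : Fin n, x i.castSucc ^ 2 = (N + x (Fin.last n)) * (N - x (Fin.last n)) := by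
        linear_combination -hN2
      rw [this]
      field_simp
      ring
    · simp [parabolicPoint]

theorem fderiv_parabolicPoint {n : ℕ} (η : Fin n → ℝ) (k : Fin n) :
    spatial (fderiv ℝ parabolicPoint η (Pi.single k 1)) =
      Fin.snoc (α := fun _ => ℝ) (Pi.single k 1) (-η k) := by
  have h := hasFDerivAt_pi'.1
    (contDiff_parabolicPoint.differentiable one_ne_zero η).hasFDerivAt
  funext j
  refine Fin.lastCases ?_ (fun j => ?_) j
  · have h1 : HasFDerivAt (fun x : Fin n → ℝ => parabolicPoint x (Fin.last n).succ)
        (-∑ i : Fin n, η i • (ContinuousLinearMap.proj (R := ℝ) (φ := fun _ : Fin n => ℝ) i)) η := by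
      simp only [parabolicPoint, Fin.cons_succ, Fin.snoc_last]
      have := ((HasFDerivAt.fun_sum (u := Finset.univ) fun i _ =>
        (hasFDerivAt_apply (𝕜 := ℝ) i η).pow 2).const_sub 1).mul_const (1 / 2 : ℝ)
      refine (this.congr_fderiv ?_).congr_of_eventuallyEq (.of_forall fun x => by simp; ring)
      ext v
      simp [Finset.mul_sum]
      refine Finset.sum_congr rfl fun i _ => by ring
    have h2 := congrArg (fun L => L (Pi.single k 1)) ((h (Fin.last n).succ).unique h1)
    simp only [spatial, Fin.snoc_last]
    refine Eq.trans h2 ?_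
    simp [Pi.single_apply]
  · have h1 : HasFDerivAt (fun x : Fin n → ℝ => parabolicPoint x j.castSucc.succ)
        (ContinuousLinearMap.proj (R := ℝ) (φ := fun _ : Fin n => ℝ) j) η := by
      simp only [parabolicPoint, Fin.cons_succ, Fin.snoc_castSucc]
      exact hasFDerivAt_apply j η
    have h2 := congrArg (fun L => L (Pi.single k 1)) ((h j.castSucc.succ).unique h1)
    simp only [spatial, Fin.snoc_castSucc]
    exact h2

/-- Subtracting `ηᵢ` times the tangent rows from the radial row leaves `(0, …, 0, ξ⁰)`. The
determinant is thus `±ξ⁰`, and the prefactor `1/ξ⁰` of `α` cancels it. -/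
theorem abs_pullbackDensity_parabolicPoint {n : ℕ} (η : Fin n → ℝ) :
    |pullbackDensity parabolicPoint univ η| = 1 := by
  have hS : 0 ≤ ∑ i, η i ^ 2 := Finset.sum_nonneg fun _ _ => sq_nonneg _
  have h0 : parabolicPoint η 0 = (1 + ∑ i, η i ^ 2) / 2 := rfl
  have hsp : spatial (parabolicPoint η) =
    Fin.snoc (α := fun _ => ℝ) η ((1 - ∑ i, η i ^ 2) / 2) := rfl
  rw [pullbackDensity, coneForm_eq_det, fderivWithin_univ]
  simp only [fderiv_parabolicPoint]
  set M := rows (spatial (parabolicPoint η)) fun i =>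
    Fin.snoc (α := fun _ => ℝ) (Pi.single i 1) (-η i) with hM
  have hrow : ∑ k, (Fin.cons 1 (-η) : Fin (n + 1) → ℝ) k • M k =
      Fin.snoc (α := fun _ => ℝ) 0 ((1 + ∑ i, η i ^ 2) / 2) := by
    rw [Fin.sum_univ_succ]
    funext j
    simp only [hM, rows, hsp, Matrix.of_apply, Fin.cons_zero, Fin.cons_succ, Pi.add_apply,
      Finset.sum_apply, Pi.smul_apply, smul_eq_mul, Pi.neg_apply]
    refine Fin.lastCases ?_ (fun j => ?_) j
    · simp only [Fin.snoc_last]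
      have : ∀ x, -η x * -η x = η x ^ 2 := fun x => by ring
      simp only [this]
      ring
    · simp [Fin.snoc_castSucc, Pi.single_apply]
  have hdet := Matrix.det_updateRow_sum M 0 (Fin.cons 1 (-η))
  rw [hrow, Fin.cons_zero, one_smul] at hdet
  rw [← hdet, Matrix.det_succ_row_zero, Fin.sum_univ_castSucc]
  have hsub : (M.updateRow 0 (Fin.snoc (α := fun _ => ℝ) 0 ((1 + ∑ i, η i ^ 2) / 2))).submatrix
      Fin.succ (Fin.last n).succAbove = 1 := by
    ext i j
    simp [hM, rows, Matrix.one_apply, Pi.single_apply, eq_comm]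
  rw [hsub]
  simp only [Matrix.updateRow_self, Fin.snoc_castSucc, Fin.snoc_last, Pi.zero_apply, mul_zero,
    zero_mul, Finset.sum_const_zero, zero_add, Matrix.det_one, mul_one, h0]
  rw [abs_mul, abs_mul, abs_pow, abs_neg, abs_one, one_pow, one_mul, ← abs_mul,
    inv_mul_cancel₀ (by positivity), abs_one]

/-! ### The spherical basis -/

theorem sphericalCoord_zero {n : ℕ} (θ : Fin (n + 1) → ℝ) :
    sphericalCoord θ 0 = Real.cos (θ 0) := by
  simp [sphericalCoord]

theorem sphericalCoord_succ {n : ℕ} (θ : Fin (n + 1) → ℝ) (j : Fin (n + 1)) :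
    sphericalCoord θ j.succ = Real.sin (θ 0) * sphericalCoord (spatial θ) j := by
  unfold sphericalCoord
  rw [Fin.prod_univ_succ]
  simp [mul_assoc, spatial]

theorem differentiable_sphericalCoord {n : ℕ} : Differentiable ℝ (sphericalCoord (n := n)) := by
  refine ContDiff.differentiable (n := 1) ?_ one_ne_zero
  rw [contDiff_pi]
  intro j
  simp only [sphericalCoord]
  refine ContDiff.mul (contDiff_prod fun i _ => ?_) ?_
  · split_ifs <;> fun_prop
  · split_ifs <;> fun_prop

theorem fderiv_sphericalCoord {n : ℕ} (θ v : Fin (n + 1) → ℝ) :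
    fderiv ℝ sphericalCoord θ v =
      Fin.cons (-Real.sin (θ 0) * v 0) ((Real.cos (θ 0) * v 0) • sphericalCoord (spatial θ) +
        Real.sin (θ 0) • fderiv ℝ sphericalCoord (spatial θ) (spatial v)) := by
  have h := hasFDerivAt_pi'.1 (differentiable_sphericalCoord θ).hasFDerivAt
  have hθ := hasFDerivAt_apply (𝕜 := ℝ) (0 : Fin (n + 1)) θ
  funext j
  refine Fin.cases ?_ (fun j => ?_) j
  · have h1 := hθ.cos.congr_of_eventuallyEq (.of_forall fun x => sphericalCoord_zero x)
    have h2 := congrArg (fun L => L v) ((h 0).unique h1)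
    refine Eq.trans h2 ?_
    simp
  · have hs := hasFDerivAt_pi'.1 (differentiable_sphericalCoord (spatial θ)).hasFDerivAt j
    have h1 := (hθ.sin.mul (hs.comp θ (spatialCLM n).hasFDerivAt)).congr_of_eventuallyEq
      (.of_forall fun x => sphericalCoord_succ x j)
    have h2 := congrArg (fun L => L v) ((h j.succ).unique h1)
    refine Eq.trans h2 ?_
    simp
    ring

/-- The Jacobian of spherical coordinates, by induction on the dimension. -/
theorem det_rows_sphericalCoord_succ {n : ℕ} (θ : Fin (n + 1) → ℝ) :
    (rows (sphericalCoord θ) fun k => fderiv ℝ sphericalCoord θ (Pi.single k 1)).det =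
      Real.sin (θ 0) ^ n * (rows (sphericalCoord (spatial θ)) fun k =>
        fderiv ℝ sphericalCoord (spatial θ) (Pi.single k 1)).det := by
  set y := sphericalCoord (spatial θ) with hy
  set D := fun k : Fin n => fderiv ℝ sphericalCoord (spatial θ) (Pi.single k 1) with hD
  have e0 : fderiv ℝ sphericalCoord θ (Pi.single 0 1) =
      Fin.cons (-Real.sin (θ 0)) (Real.cos (θ 0) • y) := by
    have : spatial (Pi.single (0 : Fin (n + 1)) (1 : ℝ)) = 0 := by
      funext k; simp [spatial]
    rw [fderiv_sphericalCoord, this, map_zero]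
    simp [hy]
  have e1 : ∀ k : Fin n, fderiv ℝ sphericalCoord θ (Pi.single k.succ 1) =
      Fin.cons 0 (Real.sin (θ 0) • D k) := by
    intro k
    have : spatial (Pi.single k.succ (1 : ℝ)) = Pi.single k (1 : ℝ) := by
      funext j; simp [spatial, Pi.single_apply]
    rw [fderiv_sphericalCoord, this]
    simp [hD]
  -- Only the entries `cos θ₀` and `-sin θ₀` of the first column survive. Their minors are `cos θ₀`
  -- and `sin θ₀` times the same quantity, so the sum collapses by `cos² + sin² = 1`.
  rw [Matrix.det_succ_column_zero, Fin.sum_univ_succ, Fin.sum_univ_succ]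
  have hz : ∀ k : Fin n, (rows (sphericalCoord θ) fun k =>
      fderiv ℝ sphericalCoord θ (Pi.single k 1)) k.succ.succ 0 = 0 := by
    intro k
    simp only [rows, Matrix.of_apply, Fin.cons_succ, e1, Fin.cons_zero]
  have h0 : (rows (sphericalCoord θ) fun k => fderiv ℝ sphericalCoord θ (Pi.single k 1)) 0 0 =
      Real.cos (θ 0) := sphericalCoord_zero θ
  have h1 : (rows (sphericalCoord θ) fun k =>
      fderiv ℝ sphericalCoord θ (Pi.single k 1)) (Fin.succ 0) 0 = -Real.sin (θ 0) := by
    simp only [rows, Matrix.of_apply, Fin.cons_succ, e0, Fin.cons_zero]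
  have m0 : (rows (sphericalCoord θ) fun k =>
      fderiv ℝ sphericalCoord θ (Pi.single k 1)).submatrix (Fin.succAbove 0) Fin.succ =
      rows (Real.cos (θ 0) • y) fun k => Real.sin (θ 0) • D k := by
    ext i j
    refine Fin.cases ?_ (fun i => ?_) i
    · simp [rows, e0]
    · simp [rows, e1]
  have m1 : (rows (sphericalCoord θ) fun k =>
      fderiv ℝ sphericalCoord θ (Pi.single k 1)).submatrix (Fin.succAbove (Fin.succ 0)) Fin.succ =
      rows (Real.sin (θ 0) • y) fun k => Real.sin (θ 0) • D k := by
    ext i j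
    refine Fin.cases ?_ (fun i => ?_) i
    · simp [rows, sphericalCoord_succ, hy]
    · have : (Fin.succAbove (Fin.succ (0 : Fin (n + 1))) i.succ) = i.succ.succ := by
        rw [Fin.succ_succAbove_succ, Fin.succAbove_zero]
      simp only [Matrix.submatrix_apply, this, rows, Matrix.of_apply, Fin.cons_succ, e1]
  rw [m0, m1, h0, h1]
  simp only [hz, mul_zero, zero_mul, Finset.sum_const_zero, add_zero, det_rows_smul,
    det_rows_smul_left]
  simp only [Fin.val_zero, pow_zero, one_mul, Fin.val_succ, zero_add, pow_one]
  linear_combination (Real.sin (θ 0) ^ n * (rows y D).det) * Real.sin_sq_add_cos_sq (θ 0)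

theorem det_rows_sphericalCoord_nonneg {n : ℕ} {θ : Fin n → ℝ}
    (hθ : ∀ i : Fin n, (i : ℕ) + 1 ≠ n → 0 ≤ Real.sin (θ i)) :
    0 ≤ (rows (sphericalCoord θ) fun k => fderiv ℝ sphericalCoord θ (Pi.single k 1)).det := by
  induction n with
  | zero =>
    rw [Matrix.det_fin_one]
    simp [rows, sphericalCoord]
  | succ n ih =>
    rw [det_rows_sphericalCoord_succ]
    refine mul_nonneg ?_ (ih fun i hi => hθ i.succ (by simpa using hi))
    -- The sine of the last angle enters with exponent 0, which is why that angle may range over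
    -- `(0, 2π)` without changing the sign.
    rcases Nat.eq_zero_or_pos n with rfl | hn
    · simp
    · exact pow_nonneg (hθ 0 (by simp; omega)) n

/-- The (open) range of the spherical angles. -/
noncomputable def angleBound {n : ℕ} (i : Fin n) : ℝ := if (i : ℕ) + 1 = n then 2 * Real.pi else Real.pi

theorem angleBound_pos {n : ℕ} (i : Fin n) : 0 < angleBound i := by
  unfold angleBound
  split_ifs <;> positivity

theorem angleBound_succ {n : ℕ} (i : Fin n) : angleBound i.succ = angleBound i := by
  simp [angleBound]

theorem sphericalAngle_eq {n : ℕ} (t : Fin n → ℝ) (i : Fin n) :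
    sphericalAngle t i = angleBound i * t i := by
  unfold sphericalAngle angleBound
  split_ifs <;> rfl

theorem eq_of_cos_eq_of_sin_eq {a b : ℝ} (ha : a ∈ Ioo 0 (2 * Real.pi))
    (hb : b ∈ Ioo 0 (2 * Real.pi)) (hc : Real.cos a = Real.cos b) (hs : Real.sin a = Real.sin b) :
    a = b := by
  obtain ⟨k, hk⟩ := Real.Angle.angle_eq_iff_two_pi_dvd_sub.1 (Real.Angle.cos_sin_inj hc hs)
  have h1 : |(k : ℝ)| < 1 := by
    have : |2 * Real.pi * k| < 2 * Real.pi := by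
      rw [← hk, abs_lt]
      constructor <;> linarith [ha.1, ha.2, hb.1, hb.2]
    rw [abs_mul, abs_of_pos Real.two_pi_pos] at this
    exact (mul_lt_iff_lt_one_right Real.two_pi_pos).1 this
  have h2 : k = 0 := by
    have : |k| < 1 := by exact_mod_cast h1
    exact Int.abs_lt_one_iff.1 this
  rw [h2] at hk
  simp at hk
  linarith

/-- An angle in `(0, π)` is recovered from its cosine and its nonzero sine is divided out; the last
angle, in `(0, 2π)`, needs both cosine and sine. -/
theorem sphericalCoord_inj {n : ℕ} {θ ψ : Fin n → ℝ} (hθ : ∀ i, θ i ∈ Ioo 0 (angleBound i))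
    (hψ : ∀ i, ψ i ∈ Ioo 0 (angleBound i)) (h : sphericalCoord θ = sphericalCoord ψ) : θ = ψ := by
  induction n with
  | zero => exact Subsingleton.elim _ _
  | succ n ih =>
    have h0 := congrFun h 0
    rw [sphericalCoord_zero, sphericalCoord_zero] at h0
    have hθ0 := hθ 0
    have hψ0 := hψ 0
    rcases Nat.eq_zero_or_pos n with rfl | hn
    · have h1 := congrFun h (Fin.succ 0)
      simp only [sphericalCoord_succ] at h1
      have : ∀ x : Fin 0 → ℝ, sphericalCoord x 0 = 1 := fun x => by simp [sphericalCoord]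
      rw [this, this, mul_one, mul_one] at h1
      simp only [angleBound, Fin.val_zero, zero_add, if_true] at hθ0 hψ0
      funext i
      obtain rfl : i = 0 := Fin.ext (by omega)
      exact eq_of_cos_eq_of_sin_eq hθ0 hψ0 h0 h1
    · have hb : angleBound (0 : Fin (n + 1)) = Real.pi := if_neg (by simp; omega)
      rw [hb] at hθ0 hψ0
      have e0 : θ 0 = ψ 0 := Real.injOn_cos ⟨hθ0.1.le, hθ0.2.le⟩ ⟨hψ0.1.le, hψ0.2.le⟩ h0
      have hs : Real.sin (ψ 0) ≠ 0 := (Real.sin_pos_of_pos_of_lt_pi hψ0.1 hψ0.2).ne'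
      have e1 : spatial θ = spatial ψ := by
        refine ih (fun i => angleBound_succ i ▸ hθ i.succ) (fun i => angleBound_succ i ▸ hψ i.succ)
          (funext fun j => ?_)
        have h1 := congrFun h j.succ
        rw [sphericalCoord_succ, sphericalCoord_succ, e0] at h1
        exact mul_left_cancel₀ hs h1
      funext i
      exact Fin.cases e0 (fun i => congrFun e1 i) i

/-- The cut of the argument is moved to the positive real axis, avoided because `b ≠ 0`. The clause
for `0 < b` serves all angles but the last, where `b` is the radius of the remaining coordinates. -/
theorem exists_polar {a b : ℝ} (hb : b ≠ 0) : ∃ r θ : ℝ, 0 < r ∧ θ ∈ Ioo 0 (2 * Real.pi) ∧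
    (0 < b → θ < Real.pi) ∧ a = r * Real.cos θ ∧ b = r * Real.sin θ := by
  set z : ℂ := ⟨a, b⟩ with hz
  have hz0 : z ≠ 0 := fun h => hb (congrArg Complex.im h)
  have hr : 0 < ‖z‖ := norm_pos_iff.2 hz0
  have hc : a = ‖z‖ * Real.cos z.arg := (Complex.norm_mul_cos_arg z).symm
  have hs : b = ‖z‖ * Real.sin z.arg := (Complex.norm_mul_sin_arg z).symm
  have h1 := Complex.neg_pi_lt_arg z
  have h2 := Complex.arg_le_pi z
  rcases hb.lt_or_gt with h | h
  · have hneg : z.arg < 0 := Complex.arg_neg_iff.2 h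
    refine ⟨‖z‖, z.arg + 2 * Real.pi, hr, ⟨by linarith, by linarith⟩, fun h' => absurd h h'.not_gt,
      ?_, ?_⟩
    · rwa [Real.cos_add_two_pi]
    · rwa [Real.sin_add_two_pi]
  · have hnn : 0 ≤ z.arg := Complex.arg_nonneg_iff.2 h.le
    have h3 : z.arg ≠ 0 := fun h0 => by rw [h0] at hs; simp at hs; exact hb hs
    have h4 : z.arg ≠ Real.pi := fun h0 => by rw [h0] at hs; simp at hs; exact hb hs
    have h5 := hnn.lt_of_ne' h3
    have h6 := h2.lt_of_ne h4
    exact ⟨‖z‖, z.arg, hr, ⟨h5, by linarith⟩, fun _ => h6, hc, hs⟩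

/-- Induction from the last coordinates: write the tail of `x` as `s` times a spherical point with
`s > 0`, then take planar polar coordinates of `(x₀, s)`. -/
theorem exists_sphericalCoord {n : ℕ} {x : Fin (n + 1 + 1) → ℝ} (hx : x (Fin.last (n + 1)) ≠ 0) :
    ∃ (r : ℝ) (θ : Fin (n + 1) → ℝ), 0 < r ∧ (∀ i, θ i ∈ Ioo 0 (angleBound i)) ∧
      x = r • sphericalCoord θ := by
  induction n with
  | zero =>
    obtain ⟨r, θ, hr, hθ, -, ha, hb⟩ := exists_polar (a := x 0) hx
    refine ⟨r, fun _ => θ, hr, fun i => ?_, ?_⟩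
    · obtain rfl : i = 0 := Fin.ext (by omega)
      simpa [angleBound] using hθ
    · funext j
      refine Fin.cases ?_ (fun j => ?_) j
      · simp [sphericalCoord_zero, ha]
      · obtain rfl : j = 0 := Fin.ext (by omega)
        simp only [Pi.smul_apply, sphericalCoord_succ]
        simp [sphericalCoord]
        exact hb
  | succ n ih =>
    obtain ⟨s, ψ, hs, hψ, hxψ⟩ := ih (x := spatial x) hx
    obtain ⟨r, θ, hr, hθ, hπ, ha, hb⟩ := exists_polar (a := x 0) hs.ne'
    refine ⟨r, Fin.cons θ ψ, hr, fun i => ?_, ?_⟩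
    · refine Fin.cases ?_ (fun i => ?_) i
      · have : angleBound (0 : Fin (n + 1 + 1)) = Real.pi := if_neg (by simp)
        rw [this]
        exact ⟨hθ.1, hπ hs⟩
      · rw [angleBound_succ]
        exact hψ i
    · have hsp : spatial (Fin.cons θ ψ : Fin (n + 1 + 1) → ℝ) = ψ := rfl
      funext j
      refine Fin.cases ?_ (fun j => ?_) j
      · simp [sphericalCoord_zero, ha]
      · rw [Pi.smul_apply, sphericalCoord_succ, hsp, Fin.cons_zero]
        have := congrFun hxψ j
        simp only [Pi.smul_apply, smul_eq_mul, spatial] at this ⊢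
        rw [this, hb]
        ring

/-- The open unit cube. -/
def openCube (n : ℕ) : Set (Fin n → ℝ) := pi univ fun _ => Ioo 0 1

theorem isOpen_openCube (n : ℕ) : IsOpen (openCube n) :=
  isOpen_set_pi finite_univ fun _ _ => isOpen_Ioo

theorem openCube_subset_Icc (n : ℕ) : openCube n ⊆ Icc 0 1 := fun _ ht =>
  ⟨fun i => (ht i (mem_univ i)).1.le, fun i => (ht i (mem_univ i)).2.le⟩

theorem openCube_ae_eq_Icc (n : ℕ) : openCube n =ᵐ[volume] Icc 0 1 :=
  Measure.univ_pi_Ioo_ae_eq_Icc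

theorem Icc_mem_nhds_of_openCube {n : ℕ} {t : Fin n → ℝ} (ht : t ∈ openCube n) :
    Icc (0 : Fin n → ℝ) 1 ∈ nhds t :=
  Filter.mem_of_superset ((isOpen_openCube n).mem_nhds ht) (openCube_subset_Icc n)

theorem sphericalAngle_mem {n : ℕ} {t : Fin n → ℝ} (ht : t ∈ openCube n) (i : Fin n) :
    sphericalAngle t i ∈ Ioo 0 (angleBound i) := by
  have h := ht i (mem_univ i)
  have hb := angleBound_pos i
  rw [sphericalAngle_eq]
  exact ⟨mul_pos hb h.1, mul_lt_of_lt_one_right hb h.2⟩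

theorem spherePoint_mem {n : ℕ} (t : Fin n → ℝ) : spherePoint t ∈ futureCone (n + 1) := by
  refine ⟨?_, ?_⟩
  · simp [mdot, spherePoint, sum_sq_sphericalCoord]
  · simp [spherePoint]

theorem spatial_spherePoint {n : ℕ} (t : Fin n → ℝ) :
    spatial (spherePoint t) = sphericalCoord (sphericalAngle t) := rfl

theorem contDiff_spherePoint {n : ℕ} : ContDiff ℝ 1 (spherePoint (n := n)) := by
  rw [contDiff_pi]
  intro j
  refine Fin.cases ?_ (fun j => ?_) j
  · simpa [spherePoint] using contDiff_const
  · simp only [spherePoint, Fin.cons_succ, sphericalCoord, sphericalAngle_eq]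
    refine ContDiff.mul (contDiff_prod fun i _ => ?_) ?_
    · split_ifs <;> fun_prop
    · split_ifs <;> fun_prop

theorem isConeBase_spherePoint {n : ℕ} (hn : 1 ≤ n) :
    IsConeBase (openCube n) (spherePoint (n := n)) where
  isOpen := isOpen_openCube n
  contDiffOn := contDiff_spherePoint.contDiffOn
  mem_cone u _ := spherePoint_mem u
  inj u hu v hv r _ h := by
    have hr : r = 1 := by simpa [spherePoint] using (congrFun h 0).symm
    rw [hr, one_smul] at h
    have h1 := sphericalCoord_inj (sphericalAngle_mem hu) (sphericalAngle_mem hv)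
      (congrArg spatial h)
    funext i
    have h2 := congrFun h1 i
    rw [sphericalAngle_eq, sphericalAngle_eq] at h2
    exact mul_left_cancel₀ (angleBound_pos i).ne' h2
  covers := by
    obtain ⟨m, rfl⟩ := Nat.exists_eq_add_of_le' hn
    have hne : ∀ᵐ x : Fin (m + 1 + 1) → ℝ, x (Fin.last (m + 1)) ≠ 0 :=
      compl_mem_ae_iff.2 (Measure.pi_hyperplane _ _ _)
    filter_upwards [hne] with x hx
    obtain ⟨r, θ, hr, hθ, hx⟩ := exists_sphericalCoord hx
    have hang : sphericalAngle (fun i => θ i / angleBound i) = θ := by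
      funext i
      rw [sphericalAngle_eq, mul_div_cancel₀ _ (angleBound_pos i).ne']
    refine ⟨fun i => θ i / angleBound i, fun i _ => ⟨div_pos (hθ i).1 (angleBound_pos i),
      (div_lt_one (angleBound_pos i)).2 (hθ i).2⟩, r⁻¹, inv_pos.2 hr, fun i => ?_⟩
    rw [hx]
    simp only [spherePoint, Fin.cons_succ, hang, Pi.smul_apply, smul_eq_mul]
    field_simp

theorem fderiv_spherePoint {n : ℕ} (t : Fin n → ℝ) (k : Fin n) :
    spatial (fderiv ℝ spherePoint t (Pi.single k 1)) =
      angleBound k • fderiv ℝ sphericalCoord (sphericalAngle t) (Pi.single k 1) := by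
  have hA : HasFDerivAt (sphericalAngle (n := n)) (ContinuousLinearMap.pi fun i =>
      angleBound i • ContinuousLinearMap.proj (R := ℝ) (φ := fun _ : Fin n => ℝ) i) t := by
    rw [hasFDerivAt_pi']
    intro i
    simp only [sphericalAngle_eq]
    exact (hasFDerivAt_apply i t).const_mul (angleBound i)
  have h1 := (differentiable_sphericalCoord (sphericalAngle t)).hasFDerivAt.comp t hA
  have h2 : HasFDerivAt (sphericalCoord ∘ sphericalAngle) _ t :=
    (spatialCLM (n + 1)).hasFDerivAt.comp t
      (contDiff_spherePoint.differentiable one_ne_zero t).hasFDerivAt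
  have h3 := congrArg (fun L => L (Pi.single k 1)) (h2.unique h1)
  refine Eq.trans h3 ?_
  simp only [ContinuousLinearMap.comp_apply]
  rw [← map_smul]
  congr 1
  funext i
  simp only [ContinuousLinearMap.pi_apply, _root_.smul_apply,
    ContinuousLinearMap.proj_apply, Pi.smul_apply, smul_eq_mul, Pi.single_apply]
  split_ifs with h
  · rw [h]
  · simp

theorem pullbackDensity_congr {n : ℕ} {φ ψ : (Fin n → ℝ) → Fin (n + 1 + 1) → ℝ}
    {S T : Set (Fin n → ℝ)} {t : Fin n → ℝ} (h : φ t = ψ t)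
    (hd : fderivWithin ℝ φ S t = fderivWithin ℝ ψ T t) :
    pullbackDensity φ S t = pullbackDensity ψ T t := by
  rw [pullbackDensity, pullbackDensity, h, hd]

/-- This is the statement about orientation: it identifies the integral of `α` over `γ₀` with that
of the measure `|α|`. -/
theorem pullbackDensity_spherePoint_nonneg {n : ℕ} {t : Fin n → ℝ} (ht : t ∈ openCube n) :
    0 ≤ pullbackDensity spherePoint (openCube n) t := by
  rw [pullbackDensity, coneForm_eq_det, fderivWithin_of_isOpen (isOpen_openCube n) ht]
  simp only [fderiv_spherePoint, spatial_spherePoint, det_rows_mul]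
  refine mul_nonneg (by simp [spherePoint]) (mul_nonneg
    (Finset.prod_nonneg fun i _ => (angleBound_pos i).le) (det_rows_sphericalCoord_nonneg ?_))
  intro i hi
  have h := sphericalAngle_mem ht i
  rw [angleBound, if_neg hi] at h
  exact (Real.sin_pos_of_pos_of_lt_pi h.1 h.2).le

theorem cubeExtend_sphereCube {n : ℕ} {t : Fin n → ℝ} (ht : t ∈ Icc (0 : Fin n → ℝ) 1) :
    cubeExtend (sphereCube n).toFun t = spherePoint t := by
  unfold cubeExtend
  refine congrArg spherePoint (funext fun i => ?_)
  exact congrArg Subtype.val (Set.projIcc_of_mem zero_le_one ⟨ht.1 i, ht.2 i⟩)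

theorem pullbackDensity_sphereCube {n : ℕ} {t : Fin n → ℝ} (ht : t ∈ openCube n) :
    pullbackDensity (cubeExtend (sphereCube n).toFun) (Icc 0 1) t =
      |pullbackDensity spherePoint (openCube n) t| := by
  rw [abs_of_nonneg (pullbackDensity_spherePoint_nonneg ht)]
  have hmem := Icc_mem_nhds_of_openCube ht
  refine pullbackDensity_congr (cubeExtend_sphereCube (openCube_subset_Icc n ht)) ?_
  rw [fderivWithin_of_mem_nhds hmem, fderivWithin_of_isOpen (isOpen_openCube n) ht]
  exact Filter.EventuallyEq.fderiv_eq
    (Filter.mem_of_superset hmem fun s hs => cubeExtend_sphereCube hs)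

/-- The spherical cycle computes the integral over the spherical basis. -/
theorem sphereCycle_eq_base {n : ℕ} (F : (Fin (n + 1 + 1) → ℝ) → ℂ) :
    (ConvergesOn F (sphereCycle n) ↔ IntegrableOn (fun u => F (spherePoint u) *
      ((|pullbackDensity spherePoint (openCube n) u| : ℝ) : ℂ)) (openCube n)) ∧
    chainIntegral F (sphereCycle n) = ∫ u in openCube n, F (spherePoint u) *
      ((|pullbackDensity spherePoint (openCube n) u| : ℝ) : ℂ) := by
  have hU := (isOpen_openCube n).measurableSet
  have he : EqOn (fun t => F (cubeExtend (sphereCube n).toFun t) *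
      (pullbackDensity (cubeExtend (sphereCube n).toFun) (Icc 0 1) t : ℂ))
      (fun u => F (spherePoint u) * ((|pullbackDensity spherePoint (openCube n) u| : ℝ) : ℂ))
      (openCube n) := by
    intro t ht
    simp only
    rw [cubeExtend_sphereCube (openCube_subset_Icc n ht), pullbackDensity_sphereCube ht]
  constructor
  · rw [← integrableOn_congr_fun he hU, integrableOn_congr_set_ae (openCube_ae_eq_Icc n)]
    simp only [ConvergesOn, sphereCycle]
    rw [Finsupp.support_single _ one_ne_zero]
    simp
  · rw [← setIntegral_congr_fun hU he, setIntegral_congr_set (openCube_ae_eq_Icc n), chainIntegral,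
      sphereCycle, Finsupp.sum_single_index (by simp)]
    simp

/-! ### The closed forms `F α` on the punctured space -/

/-- The determinant as a continuous alternating form. -/
noncomputable def detForm (n : ℕ) : (Fin n → ℝ) [⋀^Fin n]→L[ℝ] ℝ where
  __ := (Matrix.detRowAlternating : (Fin n → ℝ) [⋀^Fin n]→ₗ[ℝ] ℝ)
  cont := by
    change Continuous fun M : Matrix (Fin n) (Fin n) ℝ => M.det
    exact continuous_id.matrix_det

/-- The flux form `H ι_x (dx¹ ∧ ⋯ ∧ dx^{n+1})` of the radial vector field `H(x) x`. -/
noncomputable def fluxForm {n : ℕ} (H : (Fin (n + 1) → ℝ) → ℂ) (x : Fin (n + 1) → ℝ) :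
    (Fin (n + 1) → ℝ) [⋀^Fin n]→L[ℝ] ℂ :=
  H x • (Complex.ofRealCLM.compContinuousAlternatingMap (detForm (n + 1))).curryLeft x

theorem fluxForm_apply {n : ℕ} (H : (Fin (n + 1) → ℝ) → ℂ) (x : Fin (n + 1) → ℝ)
    (v : Fin n → Fin (n + 1) → ℝ) : fluxForm H x v = H x * ((rows x v).det : ℂ) := rfl

theorem hasFDerivAt_fluxForm {n : ℕ} {H : (Fin (n + 1) → ℝ) → ℂ} {x : Fin (n + 1) → ℝ}
    {H' : (Fin (n + 1) → ℝ) →L[ℝ] ℂ} (hH : HasFDerivAt H H' x) :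
    HasFDerivAt (fluxForm H)
      (H x • (Complex.ofRealCLM.compContinuousAlternatingMap (detForm (n + 1))).curryLeft +
        H'.smulRight
          ((Complex.ofRealCLM.compContinuousAlternatingMap (detForm (n + 1))).curryLeft x)) x :=
  hH.smul (Complex.ofRealCLM.compContinuousAlternatingMap
    (detForm (n + 1))).curryLeft.hasFDerivAt

/-- Moving `x` from the first row to row `i` costs `(-1)^i`, the sign in the formula for the
exterior derivative. -/
theorem rows_removeNth_det {n : ℕ} (v : Fin (n + 1) → Fin (n + 1) → ℝ)
    (x : Fin (n + 1) → ℝ) (i : Fin (n + 1)) :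
    (-1) ^ (i : ℕ) * (rows x (i.removeNth v)).det = ((Matrix.of v).updateRow i x).det := by
  have h := AlternatingMap.map_insertNth
    (Matrix.detRowAlternating : (Fin (n + 1) → ℝ) [⋀^Fin (n + 1)]→ₗ[ℝ] ℝ) i x (i.removeNth v)
  rw [Fin.insertNth_removeNth] at h
  rw [← Int.cast_one, ← Int.cast_neg, ← Int.cast_pow, ← zsmul_eq_mul]
  exact h.symm

/-- Cramer's rule expresses `det(v) x` as a combination of the `vᵢ`; apply `L`. With `L = dH` the
derivative terms of the flux form collapse to `det(v) dH(x)`. -/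
theorem sum_updateRow_det_mul {n : ℕ} (v : Fin (n + 1) → Fin (n + 1) → ℝ)
    (x : Fin (n + 1) → ℝ) (L : (Fin (n + 1) → ℝ) →L[ℝ] ℂ) :
    ∑ i, (((Matrix.of v).updateRow i x).det : ℂ) * L (v i) = ((Matrix.of v).det : ℂ) * L x := by
  have h := Matrix.mulVec_cramer (Matrix.of v).transpose x
  rw [Matrix.mulVec_eq_sum, Matrix.det_transpose] at h
  have h2 := congrArg L h
  rw [map_sum, map_smul] at h2
  simp only [Matrix.transpose_transpose, Matrix.cramer_transpose_apply, op_smul_eq_smul,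
    map_smul] at h2
  rw [← Complex.real_smul, ← h2]
  exact Finset.sum_congr rfl fun i _ => (Complex.real_smul ..).symm

/-- Euler's identity for a function homogeneous of degree `-(n+1)`. -/
theorem fderiv_self_of_homogeneous {n : ℕ} {H : (Fin (n + 1) → ℝ) → ℂ} {x : Fin (n + 1) → ℝ}
    {H' : (Fin (n + 1) → ℝ) →L[ℝ] ℂ} (hH : HasFDerivAt H H' x)
    (hom : ∀ r : ℝ, 0 < r → H (r • x) = (((r ^ (n + 1))⁻¹ : ℝ) : ℂ) * H x) :
    H' x = -((n : ℂ) + 1) * H x := by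
  have h1 : HasDerivAt (fun r : ℝ => H (r • x)) (H' x) 1 := by
    have hl : HasDerivAt (fun r : ℝ => r • x) x 1 := by
      simpa using (hasDerivAt_id (1 : ℝ)).smul_const x
    have hH' : HasFDerivAt H H' ((1 : ℝ) • x) := by rwa [one_smul]
    exact hH'.comp_hasDerivAt 1 hl
  have h2 : HasDerivAt (fun r : ℝ => (((r ^ (n + 1))⁻¹ : ℝ) : ℂ) * H x)
      (-((n : ℂ) + 1) * H x) 1 := by
    have h3 := (((hasDerivAt_pow (n + 1) (1 : ℝ)).inv (by simp)).ofReal_comp).mul_const (H x)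
    refine h3.congr_deriv ?_
    simp
  refine h1.unique (h2.congr_of_eventuallyEq ?_)
  filter_upwards [lt_mem_nhds (zero_lt_one (α := ℝ))] with r hr using hom r hr

/-- The form `H ι_x (dx¹ ∧ ⋯ ∧ dx^{n+1})` is closed if `H` is homogeneous of degree `-(n+1)`. -/
theorem extDeriv_fluxForm {n : ℕ} {H : (Fin (n + 1) → ℝ) → ℂ} {x : Fin (n + 1) → ℝ}
    (hH : DifferentiableAt ℝ H x)
    (hom : ∀ r : ℝ, 0 < r → H (r • x) = (((r ^ (n + 1))⁻¹ : ℝ) : ℂ) * H x) :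
    extDeriv (fluxForm H) x = 0 := by
  ext v
  have hd := hasFDerivAt_fluxForm hH.hasFDerivAt
  -- Summed over `i`, the first terms give `(n+1) H det(v)` and the second `det(v) dH(x)`, which
  -- cancel by Euler's identity.
  have key : ∀ i : Fin (n + 1), (-1) ^ (i : ℕ) • (fderiv ℝ (fluxForm H) x (v i)) (i.removeNth v) =
      H x * ((Matrix.of v).det : ℂ) +
        (((Matrix.of v).updateRow i x).det : ℂ) * fderiv ℝ H x (v i) := by
    intro i
    have e1 := rows_removeNth_det v x i
    have e2 := rows_removeNth_det v (v i) i
    have e3 : (Matrix.of v).updateRow i (v i) = Matrix.of v := Matrix.updateRow_eq_self _ i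
    rw [e3] at e2
    rw [← e1, ← e2, hd.fderiv]
    change (-1) ^ (i : ℕ) • (H x * ((rows (v i) (i.removeNth v)).det : ℂ) +
      fderiv ℝ H x (v i) * ((rows x (i.removeNth v)).det : ℂ)) = _
    push_cast
    rw [zsmul_eq_mul]
    push_cast
    ring
  rw [extDeriv, ContinuousAlternatingMap.alternatizeUncurryFin_apply, Finset.sum_congr rfl
    fun i _ => key i, Finset.sum_add_distrib, sum_updateRow_det_mul,
    fderiv_self_of_homogeneous hH.hasFDerivAt hom]
  simp
  ring

/-! ### Stokes' theorem for cubes in the cone -/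

/-- The boundary integral of a closed form over the unit cube vanishes. -/
theorem sum_face_integral_eq_zero {n : ℕ} {E : Type*} [NormedAddCommGroup E] [NormedSpace ℝ E]
    {w : E → E [⋀^Fin n]→L[ℝ] ℂ} {g : (Fin (n + 1) → ℝ) → E} (hg : ContDiffOn ℝ ∞ g (Icc 0 1))
    (hw : ∀ t ∈ Icc (0 : Fin (n + 1) → ℝ) 1, DifferentiableAt ℝ w (g t))
    (hd : ∀ t ∈ Icc (0 : Fin (n + 1) → ℝ) 1, extDeriv w (g t) = 0) :
    ∑ i : Fin (n + 1), (-1 : ℂ) ^ (i : ℕ) *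
      ((∫ s in Icc (0 : Fin n → ℝ) 1, w (g (i.insertNth (α := fun _ => ℝ) 1 s)) fun k =>
          fderivWithin ℝ g (Icc 0 1) (i.insertNth (α := fun _ => ℝ) 1 s)
            (Pi.single (i.succAbove k) 1)) -
        ∫ s in Icc (0 : Fin n → ℝ) 1, w (g (i.insertNth (α := fun _ => ℝ) 0 s)) fun k =>
          fderivWithin ℝ g (Icc 0 1) (i.insertNth (α := fun _ => ℝ) 0 s)
            (Pi.single (i.succAbove k) 1)) = 0 := by
  set e : Fin (n + 1) → Fin (n + 1) → ℝ := fun i => Pi.single i 1 with he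
  -- A vector field whose divergence is the exterior derivative of the pullback of `w` evaluated on
  -- the standard basis, and whose fluxes through the faces are the integrals in the statement.
  set f : Fin (n + 1) → (Fin (n + 1) → ℝ) → ℂ := fun i t =>
    (-1 : ℂ) ^ (i : ℕ) * w (g t) fun k => fderivWithin ℝ g (Icc 0 1) t (e (i.succAbove k)) with hf
  have huniq : UniqueDiffOn ℝ (Icc (0 : Fin (n + 1) → ℝ) 1) := by
    rw [← pi_univ_Icc]
    exact UniqueDiffOn.univ_pi fun i => uniqueDiffOn_Icc zero_lt_one
  have hcont : ∀ i, ContinuousOn (f i) (Icc 0 1) := by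
    intro i
    refine continuousOn_const.mul ?_
    have h1 : ContinuousOn (fun t => w (g t)) (Icc 0 1) := fun t ht =>
      (hw t ht).continuousAt.comp_continuousWithinAt (hg.continuousOn t ht)
    have h2 := hg.continuousOn_fderivWithin huniq (by simp)
    have h3 : ContinuousOn (fun t (k : Fin n) =>
        fderivWithin ℝ g (Icc 0 1) t (e (i.succAbove k))) (Icc 0 1) :=
      continuousOn_pi.2 fun k => h2.clm_apply continuousOn_const
    exact h1.eval h3
  -- The pullback is differentiated only in the open cube, where `fderiv` and `fderivWithin` agree;
  -- the divergence theorem asks merely for continuity up to the boundary.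
  set p : (Fin (n + 1) → ℝ) → (Fin (n + 1) → ℝ) [⋀^Fin n]→L[ℝ] ℂ :=
    fun t => (w (g t)).compContinuousLinearMap (fderiv ℝ g t) with hp
  have hgat : ∀ t ∈ openCube (n + 1), ContDiffAt ℝ ∞ g t := fun t ht =>
    hg.contDiffAt (Icc_mem_nhds_of_openCube ht)
  have hpd : ∀ t ∈ openCube (n + 1), DifferentiableAt ℝ p t := by
    intro t ht
    refine DifferentiableAt.continuousAlternatingMapCompContinuousLinearMap ?_ ?_
    · exact (hw t (openCube_subset_Icc _ ht)).comp t ((hgat t ht).differentiableAt (by simp))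
    · exact ((hgat t ht).fderiv_right (m := ∞) (by simp)).differentiableAt (by simp)
  have hfp : ∀ t ∈ openCube (n + 1), ∀ i, f i =ᶠ[nhds t] fun t =>
      (-1 : ℂ) ^ (i : ℕ) * p t (Fin.removeNth i e) := by
    intro t ht i
    filter_upwards [(isOpen_openCube (n + 1)).mem_nhds ht] with s hs
    simp only [hf, hp]
    rw [fderivWithin_of_mem_nhds (Icc_mem_nhds_of_openCube hs)]
    rfl
  have hpi : ∀ t ∈ openCube (n + 1), ∀ i, DifferentiableAt ℝ (fun t => p t (Fin.removeNth i e)) t :=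
    fun t ht i => (hpd t ht).continuousAlternatingMap_apply fun _ => differentiableAt_const _
  have hdiv : ∀ t ∈ openCube (n + 1), ∑ i, fderiv ℝ (f i) t (e i) = 0 := by
    intro t ht
    have h1 : extDeriv p t e = 0 := by
      rw [hp, extDeriv_pullback (hw t (openCube_subset_Icc _ ht)) (hgat t ht)
        (by simpa using WithTop.coe_le_coe.2 (le_top : (2 : ℕ∞) ≤ ⊤)),
        hd t (openCube_subset_Icc _ ht)]
      rfl
    rw [extDeriv_apply (hpd t ht)] at h1
    rw [← h1]
    refine Finset.sum_congr rfl fun i _ => ?_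
    rw [(hfp t ht i).fderiv_eq, fderiv_const_mul (hpi t ht i)]
    simp
  have hzero : (fun t => ∑ i, fderiv ℝ (f i) t (e i)) =ᵐ[volume.restrict (Icc 0 1)] 0 := by
    rw [← Measure.restrict_congr_set (openCube_ae_eq_Icc (n + 1))]
    exact (ae_restrict_iff' (isOpen_openCube _).measurableSet).2 (.of_forall hdiv)
  have hmain := integral_divergence_of_hasFDerivAt_off_countable' (0 : Fin (n + 1) → ℝ) 1
    zero_le_one f (fun i => fderiv ℝ (f i)) ∅ countable_empty hcont
    (fun t ht i => by
      have ht' : t ∈ openCube (n + 1) := ht.1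
      exact (((hpi t ht' i).const_mul _).congr_of_eventuallyEq (hfp t ht' i)).hasFDerivAt)
    ((integrable_congr hzero).2 (integrable_zero _ _ _))
  rw [integral_congr_ae hzero] at hmain
  simp only [Pi.zero_apply, integral_zero] at hmain
  rw [hmain]
  refine Finset.sum_congr rfl fun i _ => ?_
  rw [mul_sub, ← integral_const_mul, ← integral_const_mul]
  rfl

/-- Projecting the cone to its spatial part replaces `F α` by a form on an open subset of `ℝ^d`,
where exterior derivatives make sense; the factor `1/ξ⁰` is absorbed into the density. -/
theorem coneForm_eq_fluxForm {n : ℕ} {F : (Fin (n + 1 + 1) → ℝ) → ℂ} {ξ : Fin (n + 1 + 1) → ℝ}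
    (hξ : ξ ∈ futureCone (n + 1)) (v : Fin n → Fin (n + 1 + 1) → ℝ) :
    F ξ * (coneForm ξ v : ℂ) =
      fluxForm (fun x => F (coneLift x) * ((coneLift x 0 : ℝ) : ℂ)⁻¹) (spatial ξ)
        fun i => spatial (v i) := by
  rw [fluxForm_apply, coneLift_spatial hξ, coneForm_eq_det]
  push_cast
  ring

theorem differentiableAt_coneLift {d : ℕ} {x : Fin d → ℝ} (hx : x ≠ 0) :
    DifferentiableAt ℝ (coneLift (d := d)) x := by
  rw [differentiableAt_pi]
  intro j
  refine Fin.cases ?_ (fun j => ?_) j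
  · simp only [coneLift_zero]
    exact DifferentiableAt.sqrt (by fun_prop) (sum_sq_pos hx).ne'
  · simp only [coneLift_succ]
    fun_prop

theorem differentiableAt_cone_density {n : ℕ} {F : (Fin (n + 1 + 1) → ℝ) → ℂ}
    (hFd : ∀ ξ : Fin (n + 1 + 1) → ℝ, 0 < ξ 0 → DifferentiableAt ℝ F ξ)
    {x : Fin (n + 1) → ℝ} (hx : x ≠ 0) :
    DifferentiableAt ℝ (fun x => F (coneLift x) * ((coneLift x 0 : ℝ) : ℂ)⁻¹) x := by
  have hc := differentiableAt_coneLift hx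
  have h0 := (coneLift_mem hx).2
  have h1 : DifferentiableAt ℝ (fun x => coneLift x 0) x := differentiableAt_pi.1 hc 0
  refine ((hFd _ h0).comp x hc).mul (DifferentiableAt.fun_inv ?_ (by exact_mod_cast h0.ne'))
  exact Complex.ofRealCLM.differentiableAt.comp x h1

theorem cone_density_smul {n : ℕ} {F : (Fin (n + 1 + 1) → ℝ) → ℂ}
    (hF : ∀ ξ ∈ futureCone (n + 1), ∀ r : ℝ, 0 < r → F (r • ξ) = ((r ^ n)⁻¹ : ℝ) * F ξ)
    {x : Fin (n + 1) → ℝ} (hx : x ≠ 0) {r : ℝ} (hr : 0 < r) :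
    F (coneLift (r • x)) * ((coneLift (r • x) 0 : ℝ) : ℂ)⁻¹ =
      (((r ^ (n + 1))⁻¹ : ℝ) : ℂ) * (F (coneLift x) * ((coneLift x 0 : ℝ) : ℂ)⁻¹) := by
  rw [coneLift_smul hr.le, hF _ (coneLift_mem hx) r hr, Pi.smul_apply, smul_eq_mul]
  push_cast
  rw [pow_succ, mul_inv, mul_inv]
  ring

/-- The integral of `F α` over a cube. -/
noncomputable def cubeIntegral {n : ℕ} (F : (Fin (n + 1 + 1) → ℝ) → ℂ)
    (σ : ConeCube (n + 1) n) : ℂ :=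
  ∫ t in Icc (0 : Fin n → ℝ) 1, F (cubeExtend σ.toFun t) *
    (pullbackDensity (cubeExtend σ.toFun) (Icc 0 1) t : ℂ)

/-- The integral over chains as a homomorphism. -/
noncomputable def chainIntegralHom {n : ℕ} (F : (Fin (n + 1 + 1) → ℝ) → ℂ) :
    ConeChain (n + 1) n →+ ℂ :=
  Finsupp.liftAddHom fun σ => (AddMonoidHom.mulRight (cubeIntegral F σ)).comp
    (Int.castAddHom ℂ)

theorem chainIntegral_eq_hom {n : ℕ} (F : (Fin (n + 1 + 1) → ℝ) → ℂ) (c : ConeChain (n + 1) n) :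
    chainIntegral F c = chainIntegralHom F c := rfl

theorem chainIntegralHom_single {n : ℕ} (F : (Fin (n + 1 + 1) → ℝ) → ℂ) (σ : ConeCube (n + 1) n) :
    chainIntegralHom F (Finsupp.single σ 1) = cubeIntegral F σ := by
  simp [chainIntegralHom]

theorem uniqueDiffOn_Icc_pi (n : ℕ) : UniqueDiffOn ℝ (Icc (0 : Fin n → ℝ) 1) := by
  rw [← pi_univ_Icc]
  exact UniqueDiffOn.univ_pi fun i => uniqueDiffOn_Icc zero_lt_one

theorem cubeExtend_mem {d k : ℕ} (σ : ConeCube d k) (t : Fin k → ℝ) :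
    cubeExtend σ.toFun t ∈ futureCone d := σ.mem_cone _

theorem spatial_fderivWithin {n k : ℕ} {φ : (Fin k → ℝ) → Fin (n + 1) → ℝ} {S : Set (Fin k → ℝ)}
    {t : Fin k → ℝ} (hφ : DifferentiableWithinAt ℝ φ S t) (hS : UniqueDiffWithinAt ℝ S t)
    (v : Fin k → ℝ) :
    spatial (fderivWithin ℝ φ S t v) = fderivWithin ℝ (fun t => spatial (φ t)) S t v := by
  have h := ((spatialCLM n).hasFDerivAt.comp_hasFDerivWithinAt t hφ.hasFDerivWithinAt).fderivWithin
    hS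
  exact (congrArg (fun L => L v) h).symm

theorem hasFDerivAt_insertNth {n : ℕ} (i : Fin (n + 1)) (e : ℝ) (t : Fin n → ℝ) :
    ∃ L : (Fin n → ℝ) →L[ℝ] (Fin (n + 1) → ℝ),
      HasFDerivAt (fun s => i.insertNth (α := fun _ => ℝ) e s) L t ∧
      ∀ k, L (Pi.single k 1) = Pi.single (i.succAbove k) 1 := by
  refine ⟨ContinuousLinearMap.pi fun j => (i.insertNth
    (α := fun _ => (Fin n → ℝ) →L[ℝ] ℝ) 0 (fun k => ContinuousLinearMap.proj k)) j, ?_, ?_⟩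
  · rw [hasFDerivAt_pi]
    intro j
    refine Fin.succAboveCases i ?_ (fun j => ?_) j
    · simpa using hasFDerivAt_const e t
    · simpa using hasFDerivAt_apply (𝕜 := ℝ) j t
  · intro k
    funext j
    refine Fin.succAboveCases i ?_ (fun j => ?_) j
    · simp
    · simp [Pi.single_apply]

theorem insertNth_mem_Icc {n : ℕ} (i : Fin (n + 1)) {e : ℝ} (he : e ∈ Icc (0 : ℝ) 1)
    {t : Fin n → ℝ} (ht : t ∈ Icc (0 : Fin n → ℝ) 1) :
    i.insertNth (α := fun _ => ℝ) e t ∈ Icc (0 : Fin (n + 1) → ℝ) 1 := by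
  constructor
  · intro j
    refine Fin.succAboveCases i ?_ (fun j => ?_) j
    · simpa using he.1
    · simpa using ht.1 j
  · intro j
    refine Fin.succAboveCases i ?_ (fun j => ?_) j
    · simpa using he.2
    · simpa using ht.2 j

/-- The chain rule through the inclusion of the face brings the integral into the shape of
`sum_face_integral_eq_zero`. -/
theorem cubeIntegral_face {n : ℕ} (F : (Fin (n + 1 + 1) → ℝ) → ℂ) (σ : ConeCube (n + 1) (n + 1))
    (i : Fin (n + 1)) (e : unitInterval) :
    cubeIntegral F (σ.face i e) = ∫ s in Icc (0 : Fin n → ℝ) 1,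
      fluxForm (fun x => F (coneLift x) * ((coneLift x 0 : ℝ) : ℂ)⁻¹)
        (spatial (cubeExtend σ.toFun (i.insertNth (α := fun _ => ℝ) (e : ℝ) s))) fun k =>
          fderivWithin ℝ (fun t => spatial (cubeExtend σ.toFun t)) (Icc 0 1)
            (i.insertNth (α := fun _ => ℝ) (e : ℝ) s) (Pi.single (i.succAbove k) 1) := by
  refine setIntegral_congr_fun measurableSet_Icc fun s hs => ?_
  have hmem := insertNth_mem_Icc i e.2 hs
  have hdσ := σ.smooth.differentiableOn (by simp) _ hmem
  have hface : cubeExtend (σ.face i e).toFun =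
      fun t => cubeExtend σ.toFun (i.insertNth (α := fun _ => ℝ) (e : ℝ) t) :=
    funext fun t => cubeExtend_insertNth σ.toFun i e t
  obtain ⟨L, hL, hLk⟩ := hasFDerivAt_insertNth i (e : ℝ) s
  have hd : fderivWithin ℝ (cubeExtend (σ.face i e).toFun) (Icc 0 1) s =
      (fderivWithin ℝ (cubeExtend σ.toFun) (Icc 0 1)
        (i.insertNth (α := fun _ => ℝ) (e : ℝ) s)).comp L := by
    rw [hface]
    exact (hdσ.hasFDerivWithinAt.comp s hL.hasFDerivWithinAt
      fun t ht => insertNth_mem_Icc i e.2 ht).fderivWithin (uniqueDiffOn_Icc_pi n s hs)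
  rw [pullbackDensity, coneForm_eq_fluxForm (cubeExtend_mem (σ.face i e) s), hd, hface]
  congr 1
  funext k
  rw [ContinuousLinearMap.comp_apply, hLk]
  exact spatial_fderivWithin hdσ (uniqueDiffOn_Icc_pi _ _ hmem) _

/-- Stokes' theorem: a closed form `F α` integrates to zero over boundaries. -/
theorem chainIntegral_boundary {n : ℕ} {F : (Fin (n + 1 + 1) → ℝ) → ℂ}
    (hF : ∀ ξ ∈ futureCone (n + 1), ∀ r : ℝ, 0 < r → F (r • ξ) = ((r ^ n)⁻¹ : ℝ) * F ξ)
    (hFd : ∀ ξ : Fin (n + 1 + 1) → ℝ, 0 < ξ 0 → DifferentiableAt ℝ F ξ)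
    (b : ConeChain (n + 1) (n + 1)) : chainIntegral F (boundary b) = 0 := by
  rw [chainIntegral_eq_hom, boundary, map_finsuppSum]
  refine Finset.sum_eq_zero fun σ _ => ?_
  beta_reduce
  rw [map_zsmul, map_sum]
  simp only [map_zsmul, map_sub, chainIntegralHom_single, cubeIntegral_face]
  have hsm : ContDiffOn ℝ ∞ (fun t => spatial (cubeExtend σ.toFun t)) (Icc 0 1) :=
    (spatialCLM (n + 1)).contDiff.comp_contDiffOn σ.smooth
  have hne : ∀ t, spatial (cubeExtend σ.toFun t) ≠ 0 := fun t =>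
    spatial_ne_zero (cubeExtend_mem σ t)
  have h := sum_face_integral_eq_zero
    (w := fluxForm fun x => F (coneLift x) * ((coneLift x 0 : ℝ) : ℂ)⁻¹) hsm
    (fun t _ => (hasFDerivAt_fluxForm
      (differentiableAt_cone_density hFd (hne t)).hasFDerivAt).differentiableAt)
    (fun t _ => extDeriv_fluxForm (differentiableAt_cone_density hFd (hne t))
      fun r hr => cone_density_smul hF (hne t) hr)
  refine smul_eq_zero_of_right _ (Eq.trans (Finset.sum_congr rfl fun i _ => ?_) h)
  rw [zsmul_eq_mul]
  push_cast
  rfl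

theorem cubeIntegral_of_isDegenerate {n : ℕ} (F : (Fin (n + 1 + 1) → ℝ) → ℂ)
    {σ : ConeCube (n + 1) n} (hσ : σ.IsDegenerate) : cubeIntegral F σ = 0 := by
  obtain ⟨i, hi⟩ := hσ
  refine setIntegral_eq_zero_of_forall_eq_zero fun t ht => ?_
  -- The cube is unchanged by first freezing coordinate `i`, a map whose derivative kills the `i`-th
  -- basis vector. The chain rule within the closed cube covers boundary points too. The determinant
  -- of `α` then has a zero row.
  have hd : fderivWithin ℝ (cubeExtend σ.toFun) (Icc 0 1) t (Pi.single i 1) = 0 := by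
    have hdσ := (σ.smooth.differentiableOn (by simp) _ ht).hasFDerivWithinAt
    have hl : HasFDerivWithinAt (fun s : Fin n → ℝ => Function.update s i (t i))
        (ContinuousLinearMap.id ℝ _ - (ContinuousLinearMap.proj (R := ℝ)
          (φ := fun _ : Fin n => ℝ) i).smulRight (Pi.single i (1 : ℝ))) (Icc 0 1) t := by
      rw [hasFDerivWithinAt_pi']
      intro j
      rcases eq_or_ne j i with rfl | hj
      · simp only [Function.update_self]
        refine (hasFDerivWithinAt_const (t j) t _).congr_fderiv ?_
        ext v
        simp
      · simp only [Function.update_of_ne hj]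
        refine (hasFDerivWithinAt_apply j t _).congr_fderiv ?_
        ext v
        simp [hj]
    have hmap : MapsTo (fun s : Fin n → ℝ => Function.update s i (t i)) (Icc 0 1) (Icc 0 1) := by
      intro s hs
      constructor
      · intro j
        rcases eq_or_ne j i with rfl | hj
        · simpa using ht.1 j
        · simpa [hj] using hs.1 j
      · intro j
        rcases eq_or_ne j i with rfl | hj
        · simpa using ht.2 j
        · simpa [hj] using hs.2 j
    have hup : Function.update t i (t i) = t := Function.update_eq_self i t
    have hcomp := HasFDerivWithinAt.comp (g := cubeExtend σ.toFun) t (by rwa [hup]) hl hmap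
    have heq : cubeExtend σ.toFun ∘ (fun s : Fin n → ℝ => Function.update s i (t i)) =
        cubeExtend σ.toFun := by
      funext s
      simp only [Function.comp_apply, cubeExtend]
      rw [← hi (fun j => projIcc 0 1 zero_le_one (s j)) (projIcc 0 1 zero_le_one (t i))]
      congr 1
      funext j
      rcases eq_or_ne j i with rfl | hj
      · simp
      · simp [hj]
    rw [heq] at hcomp
    have h2 := congrArg (fun L => L (Pi.single i 1)) (hcomp.fderivWithin (uniqueDiffOn_Icc_pi n t ht))
    simpa using h2
  have : pullbackDensity (cubeExtend σ.toFun) (Icc 0 1) t = 0 := by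
    rw [pullbackDensity, coneForm_eq_det]
    refine mul_eq_zero_of_right _ (Matrix.det_eq_zero_of_row_eq_zero i.succ fun j => ?_)
    simp [rows, hd, spatial]
  rw [this]
  simp

theorem chainIntegral_of_degenerate {n : ℕ} (F : (Fin (n + 1 + 1) → ℝ) → ℂ)
    {e : ConeChain (n + 1) n} (he : ∀ σ ∈ e.support, σ.IsDegenerate) : chainIntegral F e = 0 := by
  exact Finset.sum_eq_zero fun σ hσ =>
    mul_eq_zero_of_right _ (cubeIntegral_of_isDegenerate F (he σ hσ))

theorem chainIntegral_eq_of_homologous {n : ℕ} {F : (Fin (n + 1 + 1) → ℝ) → ℂ}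
    (hF : ∀ ξ ∈ futureCone (n + 1), ∀ r : ℝ, 0 < r → F (r • ξ) = ((r ^ n)⁻¹ : ℝ) * F ξ)
    (hFd : ∀ ξ : Fin (n + 1 + 1) → ℝ, 0 < ξ 0 → DifferentiableAt ℝ F ξ)
    {c c' : ConeChain (n + 1) n} (h : Homologous c c') : chainIntegral F c = chainIntegral F c' := by
  obtain ⟨b, e, he, rfl⟩ := h
  have h1 := chainIntegral_boundary hF hFd b
  have h2 := chainIntegral_of_degenerate F he
  rw [chainIntegral_eq_hom] at h1 h2 ⊢
  rw [map_add, map_add, h1, h2, add_zero, add_zero, chainIntegral_eq_hom]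

/-! ### Cutting off the singular generatrices -/

/-- A smooth cutoff, homogeneous of degree zero, vanishing near the generatrix of `η`. -/
noncomputable def rayCutoff {d : ℕ} (k : ℕ) (η ξ : Fin (d + 1) → ℝ) : ℝ :=
  Real.smoothTransition (k * (mdot ξ η / ξ 0) - 1)

theorem rayCutoff_smul {d : ℕ} (k : ℕ) (η ξ : Fin (d + 1) → ℝ) {r : ℝ} (hr : 0 < r) :
    rayCutoff k η (r • ξ) = rayCutoff k η ξ := by
  rw [rayCutoff, mdot_smul_left, Pi.smul_apply, smul_eq_mul, mul_div_mul_left _ _ hr.ne']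
  rfl

theorem abs_rayCutoff_le {d : ℕ} (k : ℕ) (η ξ : Fin (d + 1) → ℝ) : |rayCutoff k η ξ| ≤ 1 := by
  rw [rayCutoff, abs_of_nonneg (Real.smoothTransition.nonneg _)]
  exact Real.smoothTransition.le_one _

theorem measurable_mdot_left {d : ℕ} (η : Fin (d + 1) → ℝ) :
    Measurable fun ξ : Fin (d + 1) → ℝ => mdot ξ η :=
  (contDiff_mdot_left η (k := 0)).continuous.measurable

theorem measurable_rayCutoff {d : ℕ} (k : ℕ) (η : Fin (d + 1) → ℝ) :
    Measurable (rayCutoff k η) := by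
  refine Real.smoothTransition.continuous.measurable.comp ?_
  exact (((measurable_mdot_left η).div (measurable_pi_apply 0)).const_mul _).sub_const _

/-- Off the generatrix of `η` the cutoff is eventually 1. On it the product is constantly 0, and so
is the limit, because `0 ^ b = 0` for `b ≠ 0`; hence convergence holds everywhere on the cone. -/
theorem tendsto_cpow_mul_rayCutoff {d : ℕ} {b : ℂ} (hb : b ≠ 0) {η ξ : Fin (d + 1) → ℝ}
    (hη : η ∈ futureCone d) (hξ : ξ ∈ futureCone d) :
    Filter.Tendsto (fun k => (mdot ξ η : ℂ) ^ b * (rayCutoff k η ξ : ℂ)) Filter.atTop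
      (nhds ((mdot ξ η : ℂ) ^ b)) := by
  rcases (mdot_nonneg hξ hη).eq_or_lt with h | h
  · rw [← h]
    simp [Complex.zero_cpow hb]
  · have hpos : 0 < mdot ξ η / ξ 0 := div_pos h hξ.2
    refine tendsto_const_nhds.congr' ?_
    filter_upwards [(tendsto_natCast_atTop_atTop.atTop_mul_const hpos).eventually_ge_atTop 2] with k hk
    rw [rayCutoff, Real.smoothTransition.one_of_one_le (by linarith)]
    simp

/-- Where `ξ·η > 0` the power is smooth; where `ξ·η ≤ 0` the argument of the transition function is
negative, so the product vanishes in a neighbourhood. -/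
theorem differentiableAt_cpow_mul_rayCutoff {d : ℕ} (b : ℂ) (k : ℕ) (η : Fin (d + 1) → ℝ)
    {ξ : Fin (d + 1) → ℝ} (hξ : 0 < ξ 0) :
    DifferentiableAt ℝ (fun ξ => (mdot ξ η : ℂ) ^ b * (rayCutoff k η ξ : ℂ)) ξ := by
  have hm : DifferentiableAt ℝ (fun ξ : Fin (d + 1) → ℝ => mdot ξ η) ξ :=
    (contDiff_mdot_left η (k := 1)).differentiable (by simp) ξ
  have h0 : DifferentiableAt ℝ (fun ξ : Fin (d + 1) → ℝ => (ξ 0)⁻¹) ξ :=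
    DifferentiableAt.fun_inv (by fun_prop) hξ.ne'
  have hq : DifferentiableAt ℝ (fun ξ : Fin (d + 1) → ℝ => k * (mdot ξ η / ξ 0) - 1) ξ := by
    simp only [div_eq_mul_inv]
    exact ((hm.mul h0).const_mul (k : ℝ)).sub_const 1
  rcases lt_or_ge 0 (mdot ξ η) with h | h
  · have h1 : DifferentiableAt ℝ (fun ξ : Fin (d + 1) → ℝ => (mdot ξ η : ℂ) ^ b) ξ := by
      have h2 : DifferentiableAt ℂ (fun z : ℂ => z ^ b) (mdot ξ η : ℂ) :=
        (differentiableAt_id).cpow_const (Complex.ofReal_mem_slitPlane.2 h)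
      exact (h2.restrictScalars ℝ).comp ξ (Complex.ofRealCLM.differentiableAt.comp ξ hm)
    refine h1.mul (Complex.ofRealCLM.differentiableAt.comp ξ ?_)
    exact (Real.smoothTransition.contDiffAt (n := 1)).differentiableAt one_ne_zero |>.comp ξ hq
  · have h0 : (k : ℝ) * (mdot ξ η / ξ 0) - 1 < 0 := by
      have : (k : ℝ) * (mdot ξ η / ξ 0) ≤ 0 :=
        mul_nonpos_of_nonneg_of_nonpos (Nat.cast_nonneg k) (div_nonpos_of_nonpos_of_nonneg h hξ.le)
      linarith
    refine (differentiableAt_const (0 : ℂ)).congr_of_eventuallyEq ?_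
    filter_upwards [hq.continuousAt.eventually (gt_mem_nhds h0)] with x hx
    rw [rayCutoff, Real.smoothTransition.zero_of_nonpos hx.le]
    simp

/-- The star integrand with its singular generatrices cut off. -/
noncomputable def cutIntegrand {d : ℕ} (k : ℕ) (a₁ a₂ a₃ : ℂ) (ξ₁ ξ₂ ξ₃ ξ : Fin (d + 1) → ℝ) : ℂ :=
  starIntegrand a₁ a₂ a₃ ξ₁ ξ₂ ξ₃ ξ *
    ((rayCutoff k ξ₁ ξ * rayCutoff k ξ₂ ξ * rayCutoff k ξ₃ ξ : ℝ) : ℂ)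

theorem cutIntegrand_eq {d : ℕ} (k : ℕ) (a₁ a₂ a₃ : ℂ) (ξ₁ ξ₂ ξ₃ ξ : Fin (d + 1) → ℝ) :
    cutIntegrand k a₁ a₂ a₃ ξ₁ ξ₂ ξ₃ ξ =
      ((mdot ξ ξ₁ : ℂ) ^ (a₂ + a₃) * (rayCutoff k ξ₁ ξ : ℂ)) *
        ((mdot ξ ξ₂ : ℂ) ^ (a₃ + a₁) * (rayCutoff k ξ₂ ξ : ℂ)) *
        ((mdot ξ ξ₃ : ℂ) ^ (a₁ + a₂) * (rayCutoff k ξ₃ ξ : ℂ)) := by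
  simp only [cutIntegrand, starIntegrand]
  push_cast
  ring

theorem differentiableAt_cutIntegrand {d : ℕ} (k : ℕ) (a₁ a₂ a₃ : ℂ)
    (ξ₁ ξ₂ ξ₃ : Fin (d + 1) → ℝ) {ξ : Fin (d + 1) → ℝ} (hξ : 0 < ξ 0) :
    DifferentiableAt ℝ (cutIntegrand k a₁ a₂ a₃ ξ₁ ξ₂ ξ₃) ξ := by
  have h := fun b η => differentiableAt_cpow_mul_rayCutoff b k η hξ
  exact (((h _ ξ₁).mul (h _ ξ₂)).mul (h _ ξ₃)).congr_of_eventuallyEq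
    (.of_forall (cutIntegrand_eq k a₁ a₂ a₃ ξ₁ ξ₂ ξ₃))

theorem tendsto_cutIntegrand {d : ℕ} {a₁ a₂ a₃ : ℂ} (ha₁ : a₁.re < 0) (ha₂ : a₂.re < 0)
    (ha₃ : a₃.re < 0) {ξ₁ ξ₂ ξ₃ ξ : Fin (d + 1) → ℝ} (hξ₁ : ξ₁ ∈ futureCone d)
    (hξ₂ : ξ₂ ∈ futureCone d) (hξ₃ : ξ₃ ∈ futureCone d) (hξ : ξ ∈ futureCone d) :
    Filter.Tendsto (fun k => cutIntegrand k a₁ a₂ a₃ ξ₁ ξ₂ ξ₃ ξ) Filter.atTop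
      (nhds (starIntegrand a₁ a₂ a₃ ξ₁ ξ₂ ξ₃ ξ)) := by
  have hne : ∀ a b : ℂ, a.re < 0 → b.re < 0 → a + b ≠ 0 := fun a b ha hb h => by
    have := congrArg Complex.re h
    simp at this
    linarith
  simp only [cutIntegrand_eq]
  exact ((tendsto_cpow_mul_rayCutoff (hne _ _ ha₂ ha₃) hξ₁ hξ).mul
    (tendsto_cpow_mul_rayCutoff (hne _ _ ha₃ ha₁) hξ₂ hξ)).mul
    (tendsto_cpow_mul_rayCutoff (hne _ _ ha₁ ha₂) hξ₃ hξ)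

theorem norm_cutIntegrand_le {d : ℕ} (k : ℕ) (a₁ a₂ a₃ : ℂ) (ξ₁ ξ₂ ξ₃ ξ : Fin (d + 1) → ℝ) :
    ‖cutIntegrand k a₁ a₂ a₃ ξ₁ ξ₂ ξ₃ ξ‖ ≤ ‖starIntegrand a₁ a₂ a₃ ξ₁ ξ₂ ξ₃ ξ‖ := by
  rw [cutIntegrand, norm_mul, Complex.norm_real, Real.norm_eq_abs, abs_mul, abs_mul]
  refine mul_le_of_le_one_right (norm_nonneg _) ?_
  have h := fun η => abs_rayCutoff_le k η ξ
  exact mul_le_one₀ (mul_le_one₀ (h _) (abs_nonneg _) (h _)) (abs_nonneg _) (h _)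

/-- Dominated convergence on each cube: the cutoffs are at most 1, so absolute convergence of the
original integral provides the majorant. -/
theorem tendsto_chainIntegral_cutIntegrand {n : ℕ} {a₁ a₂ a₃ : ℂ} (ha₁ : a₁.re < 0)
    (ha₂ : a₂.re < 0) (ha₃ : a₃.re < 0) {ξ₁ ξ₂ ξ₃ : Fin (n + 1 + 1) → ℝ}
    (hξ₁ : ξ₁ ∈ futureCone (n + 1)) (hξ₂ : ξ₂ ∈ futureCone (n + 1))
    (hξ₃ : ξ₃ ∈ futureCone (n + 1)) {c : ConeChain (n + 1) n}
    (hc : ConvergesOn (starIntegrand a₁ a₂ a₃ ξ₁ ξ₂ ξ₃) c) :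
    Filter.Tendsto (fun k => chainIntegral (cutIntegrand k a₁ a₂ a₃ ξ₁ ξ₂ ξ₃) c) Filter.atTop
      (nhds (chainIntegral (starIntegrand a₁ a₂ a₃ ξ₁ ξ₂ ξ₃) c)) := by
  refine tendsto_finsetSum _ fun σ hσ => Filter.Tendsto.const_mul _ ?_
  have hi := hc σ hσ
  have hσm : AEMeasurable (cubeExtend σ.toFun) (volume.restrict (Icc (0 : Fin n → ℝ) 1)) :=
    σ.smooth.continuousOn.aemeasurable measurableSet_Icc
  refine tendsto_integral_of_dominated_convergence _ (fun k => ?_) hi.norm (fun k => ?_) ?_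
  · have hm : Measurable fun ξ : Fin (n + 1 + 1) → ℝ =>
        ((rayCutoff k ξ₁ ξ * rayCutoff k ξ₂ ξ * rayCutoff k ξ₃ ξ : ℝ) : ℂ) :=
      Complex.measurable_ofReal.comp (((measurable_rayCutoff k ξ₁).mul
        (measurable_rayCutoff k ξ₂)).mul (measurable_rayCutoff k ξ₃))
    refine (hi.aestronglyMeasurable.mul
      (hm.comp_aemeasurable hσm).aestronglyMeasurable).congr (.of_forall fun t => ?_)
    simp only [cutIntegrand, Pi.mul_apply, Function.comp_apply]
    ring
  · refine .of_forall fun t => ?_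
    rw [norm_mul, norm_mul]
    exact mul_le_mul_of_nonneg_right (norm_cutIntegrand_le ..) (norm_nonneg _)
  · refine .of_forall fun t => Filter.Tendsto.mul_const _ ?_
    exact tendsto_cutIntegrand ha₁ ha₂ ha₃ hξ₁ hξ₂ hξ₃ (cubeExtend_mem σ t)

/-- The integral does not depend on the cycle within its homology class. -/
theorem chainIntegral_starIntegrand_eq_of_homologous {n : ℕ} {a₁ a₂ a₃ : ℂ}
    (hsum : 2 * (a₁ + a₂ + a₃) = 1 - ((n + 1 : ℕ) : ℂ)) (ha₁ : a₁.re < 0)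
    (ha₂ : a₂.re < 0) (ha₃ : a₃.re < 0) {ξ₁ ξ₂ ξ₃ : Fin (n + 1 + 1) → ℝ}
    (hξ₁ : ξ₁ ∈ futureCone (n + 1)) (hξ₂ : ξ₂ ∈ futureCone (n + 1))
    (hξ₃ : ξ₃ ∈ futureCone (n + 1)) {c c' : ConeChain (n + 1) n} (h : Homologous c c')
    (hc : ConvergesOn (starIntegrand a₁ a₂ a₃ ξ₁ ξ₂ ξ₃) c)
    (hc' : ConvergesOn (starIntegrand a₁ a₂ a₃ ξ₁ ξ₂ ξ₃) c') :
    chainIntegral (starIntegrand a₁ a₂ a₃ ξ₁ ξ₂ ξ₃) c =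
      chainIntegral (starIntegrand a₁ a₂ a₃ ξ₁ ξ₂ ξ₃) c' := by
  have h1 := tendsto_chainIntegral_cutIntegrand ha₁ ha₂ ha₃ hξ₁ hξ₂ hξ₃ hc
  have h2 := tendsto_chainIntegral_cutIntegrand ha₁ ha₂ ha₃ hξ₁ hξ₂ hξ₃ hc'
  -- For each `k` the cut integrals over `c` and `c'` agree exactly, the cutoffs having degree 0.
  refine tendsto_nhds_unique (h1.congr fun k => ?_) h2
  refine chainIntegral_eq_of_homologous (fun ξ _ r hr => ?_)
    (fun ξ hξ => differentiableAt_cutIntegrand k a₁ a₂ a₃ ξ₁ ξ₂ ξ₃ hξ) h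
  rw [cutIntegrand, starIntegrand_smul hsum _ _ _ _ hr, rayCutoff_smul _ _ _ hr,
    rayCutoff_smul _ _ _ hr, rayCutoff_smul _ _ _ hr, mul_assoc]
  rfl

/-! ### Lorentz invariance and conclusion. -/

/-- Proper orthochronous Lorentz matrices preserve the future cone. -/
theorem IsProperOrthochronous.mulVec_mem {d : ℕ} {L : Matrix (Fin (d + 1)) (Fin (d + 1)) ℝ}
    (hL : IsProperOrthochronous L) {ξ : Fin (d + 1) → ℝ} (hξ : ξ ∈ futureCone d) :
    L.mulVec ξ ∈ futureCone d := by
  obtain ⟨hm, -, h0⟩ := hL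
  refine ⟨by rw [hm, hξ.1], ?_⟩
  set u : Fin (d + 1) → ℝ := Pi.single 0 1 with hu
  have hdot : ∀ x : Fin (d + 1) → ℝ, mdot x u = x 0 := fun x => by simp [mdot, hu]
  have hLu : L.mulVec u 0 = L 0 0 := by simp [hu]
  have h1 : mdot (L.mulVec ξ) (L.mulVec u) = ξ 0 := by rw [hm, hdot]
  have h2 : mdot (L.mulVec u) (L.mulVec u) = 1 := by rw [hm, hdot]; simp [hu]
  have h3 : mdot (L.mulVec ξ) (L.mulVec ξ) = 0 := by rw [hm, hξ.1]
  by_contra hneg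
  -- If `(Lξ)⁰ ≤ 0`, both `-Lξ` and the image `Lu` of the time axis are causal with nonnegative time
  -- component, so their product is nonnegative; by invariance it equals `-ξ⁰ < 0`.
  have h4 : 0 ≤ mdot (-L.mulVec ξ) (L.mulVec u) := by
    refine mdot_nonneg_of_sum_sq_le ?_ ?_ ?_ ?_
    · simpa using hneg
    · rw [hLu]; exact h0.le
    · simp only [mdot] at h3
      simp only [spatial, Pi.neg_apply, sq, neg_mul_neg]
      linarith
    · simp only [mdot] at h2
      simp only [spatial, sq]
      linarith
  have h5 : mdot (-L.mulVec ξ) (L.mulVec u) = -ξ 0 := by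
    rw [← neg_one_smul ℝ (L.mulVec ξ), mdot_smul_left, h1]
    ring
  have := hξ.2
  linarith

/-- The integral over the spherical cycle converges and is given by the star-triangle formula. -/
theorem sphereCycle_star_triangle {n : ℕ} (hn : 1 ≤ n) {a₁ a₂ a₃ : ℂ}
    (hsum : 2 * (a₁ + a₂ + a₃) = 1 - ((n + 1 : ℕ) : ℂ))
    (ha₁ : a₁.re < 0) (ha₂ : a₂.re < 0) (ha₃ : a₃.re < 0)
    {ξ₁ ξ₂ ξ₃ : Fin (n + 1 + 1) → ℝ}
    (hξ₁ : ξ₁ ∈ futureCone (n + 1)) (hξ₂ : ξ₂ ∈ futureCone (n + 1))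
    (hξ₃ : ξ₃ ∈ futureCone (n + 1))
    (h₁₂ : mdot ξ₁ ξ₂ ≠ 0) (h₂₃ : mdot ξ₂ ξ₃ ≠ 0) (h₃₁ : mdot ξ₃ ξ₁ ≠ 0) :
    ConvergesOn (starIntegrand a₁ a₂ a₃ ξ₁ ξ₂ ξ₃) (sphereCycle n) ∧
    chainIntegral (starIntegrand a₁ a₂ a₃ ξ₁ ξ₂ ξ₃) (sphereCycle n) =
      starConst (n + 1) a₁ a₂ a₃ *
        ((mdot ξ₁ ξ₂ : ℂ) ^ a₃ * (mdot ξ₂ ξ₃ : ℂ) ^ a₁ * (mdot ξ₃ ξ₁ : ℂ) ^ a₂) ∧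
    ∀ (U : Set (Fin n → ℝ)) (φ : (Fin n → ℝ) → Fin (n + 1 + 1) → ℝ), IsConeBase U φ →
      IntegrableOn (fun u => starIntegrand a₁ a₂ a₃ ξ₁ ξ₂ ξ₃ (φ u) *
        ((|pullbackDensity φ U u| : ℝ) : ℂ)) U ∧
      ∫ u in U, starIntegrand a₁ a₂ a₃ ξ₁ ξ₂ ξ₃ (φ u) * ((|pullbackDensity φ U u| : ℝ) : ℂ) =
        chainIntegral (starIntegrand a₁ a₂ a₃ ξ₁ ξ₂ ξ₃) (sphereCycle n) := by
  have hbase : ∀ {U : Set (Fin n → ℝ)} {φ : (Fin n → ℝ) → Fin (n + 1 + 1) → ℝ},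
      IsConeBase U φ → _ := fun h =>
    h.integral_eq (measurable_starIntegrand a₁ a₂ a₃ ξ₁ ξ₂ ξ₃)
      fun ξ _ r hr => starIntegrand_smul hsum ξ₁ ξ₂ ξ₃ ξ hr
  have hpar := integral_starIntegrand_parabolicPoint hn hsum ha₁ ha₂ ha₃ hξ₁ hξ₂ hξ₃ h₁₂ h₂₃ h₃₁
  have hparB := hbase (isConeBase_parabolicPoint hn)
  simp only [abs_pullbackDensity_parabolicPoint, Complex.ofReal_one, mul_one, integrableOn_univ,
    setIntegral_univ] at hparB
  -- Integrability passes from the parabolic basis to the weighted integral over `ℝ^d`, and from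
  -- there to every other basis; the value travels the same way.
  have hint := hparB.1.1 hpar.1
  have hsph := hbase (isConeBase_spherePoint hn)
  obtain ⟨hcyc1, hcyc2⟩ := sphereCycle_eq_base (starIntegrand a₁ a₂ a₃ ξ₁ ξ₂ ξ₃)
  refine ⟨hcyc1.2 (hsph.1.2 hint), ?_, fun U φ hφ => ⟨(hbase hφ).1.2 hint, ?_⟩⟩
  · rw [hcyc2, hsph.2, ← hparB.2, hpar.2]
  · rw [hcyc2, hsph.2, (hbase hφ).2]

end LightCone

open LightCone in
/-- The conical star-triangle relation in dimension `d = n + 1 ≥ 2`. -/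
theorem mainTheorem5 (n : ℕ) (hn : 1 ≤ n) (a₁ a₂ a₃ : ℂ)
    (hsum : 2 * (a₁ + a₂ + a₃) = 1 - ((n + 1 : ℕ) : ℂ))
    (ha₁ : a₁.re < 0) (ha₂ : a₂.re < 0) (ha₃ : a₃.re < 0)
    (ξ₁ ξ₂ ξ₃ : Fin (n + 1 + 1) → ℝ)
    (hξ₁ : ξ₁ ∈ futureCone (n + 1)) (hξ₂ : ξ₂ ∈ futureCone (n + 1))
    (hξ₃ : ξ₃ ∈ futureCone (n + 1))
    (h₁₂ : mdot ξ₁ ξ₂ ≠ 0) (h₂₃ : mdot ξ₂ ξ₃ ≠ 0) (h₃₁ : mdot ξ₃ ξ₁ ≠ 0) :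
    -- the integral over the spherical cycle converges absolutely, with the stated value
    ConvergesOn (starIntegrand a₁ a₂ a₃ ξ₁ ξ₂ ξ₃) (sphereCycle n) ∧
    chainIntegral (starIntegrand a₁ a₂ a₃ ξ₁ ξ₂ ξ₃) (sphereCycle n) =
      starConst (n + 1) a₁ a₂ a₃ *
        ((mdot ξ₁ ξ₂ : ℂ) ^ a₃ * (mdot ξ₂ ξ₃ : ℂ) ^ a₁ * (mdot ξ₃ ξ₁ : ℂ) ^ a₂) ∧
    -- it is the same over every cycle homologous to the spherical one
    (∀ c : ConeChain (n + 1) n, Homologous c (sphereCycle n) →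
      ConvergesOn (starIntegrand a₁ a₂ a₃ ξ₁ ξ₂ ξ₃) c →
      chainIntegral (starIntegrand a₁ a₂ a₃ ξ₁ ξ₂ ξ₃) c =
        chainIntegral (starIntegrand a₁ a₂ a₃ ξ₁ ξ₂ ξ₃) (sphereCycle n)) ∧
    -- and over every basis of the cone, with the measure induced by `α`
    (∀ (U : Set (Fin n → ℝ)) (φ : (Fin n → ℝ) → Fin (n + 1 + 1) → ℝ), IsConeBase U φ →
      IntegrableOn (fun u => starIntegrand a₁ a₂ a₃ ξ₁ ξ₂ ξ₃ (φ u) *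
        ((|pullbackDensity φ U u| : ℝ) : ℂ)) U ∧
      ∫ u in U, starIntegrand a₁ a₂ a₃ ξ₁ ξ₂ ξ₃ (φ u) * ((|pullbackDensity φ U u| : ℝ) : ℂ) =
        chainIntegral (starIntegrand a₁ a₂ a₃ ξ₁ ξ₂ ξ₃) (sphereCycle n)) ∧
    -- in particular over the parabolic basis, with the Lebesgue measure
    (Integrable (fun η : Fin n → ℝ => starIntegrand a₁ a₂ a₃ ξ₁ ξ₂ ξ₃ (parabolicPoint η)) ∧
      ∫ η : Fin n → ℝ, starIntegrand a₁ a₂ a₃ ξ₁ ξ₂ ξ₃ (parabolicPoint η) =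
        chainIntegral (starIntegrand a₁ a₂ a₃ ξ₁ ξ₂ ξ₃) (sphereCycle n)) ∧
    -- it is `SO₀(1,d)`-invariant
    (∀ L : Matrix (Fin (n + 1 + 1)) (Fin (n + 1 + 1)) ℝ, IsProperOrthochronous L →
      chainIntegral (starIntegrand a₁ a₂ a₃ (L.mulVec ξ₁) (L.mulVec ξ₂) (L.mulVec ξ₃))
          (sphereCycle n) =
        chainIntegral (starIntegrand a₁ a₂ a₃ ξ₁ ξ₂ ξ₃) (sphereCycle n)) := by
  obtain ⟨hconv, hval, hbase⟩ :=
    sphereCycle_star_triangle hn hsum ha₁ ha₂ ha₃ hξ₁ hξ₂ hξ₃ h₁₂ h₂₃ h₃₁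
  have hpar := integral_starIntegrand_parabolicPoint hn hsum ha₁ ha₂ ha₃ hξ₁ hξ₂ hξ₃ h₁₂ h₂₃ h₃₁
  refine ⟨hconv, hval, fun c hc hcc => ?_, hbase, ⟨hpar.1, hpar.2.trans hval.symm⟩,
    fun L hL => ?_⟩
  · exact chainIntegral_starIntegrand_eq_of_homologous hsum ha₁ ha₂ ha₃ hξ₁ hξ₂ hξ₃ hc hcc hconv
  · have hm := hL.1
    have hL' := sphereCycle_star_triangle hn hsum ha₁ ha₂ ha₃ (hL.mulVec_mem hξ₁)
      (hL.mulVec_mem hξ₂) (hL.mulVec_mem hξ₃) (by rwa [hm]) (by rwa [hm]) (by rwa [hm])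
    -- The closed formula depends on the `ξᵢ` only through their Lorentz products.
    rw [hL'.2.1, hval, hm, hm, hm]
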